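/- **Theorem 2.2 (One-weighted estimates for $\mathcal M_{\mathcal R,\alpha}$).** Let $m,n\ge 1$ be integers. Let $\mathcal R$ be the family of all bounded nondegenerate rectangles in $\mathbb R^n$ with sides parallel to the coordinate axes, and let $\mathcal{DR}\subset\mathcal R$ be the family of dyadic rectangles $\prod_{j=1}^n[l_j2^{k_j},(l_j+1)2^{k_j})$ with $k_j,l_j\in\mathbb Z$. For locally integrable $f_1,\dots,f_m$ on $\mathbb R^n$ put $$\mathcal M_{\mathcal R,\alpha}(\vec f)(x)=\sup_{R\in\mathcal R,\;R\ni x}\ \prod_{i=1}^m\frac1{|R|^{1-\frac{\alpha}{mn}}}\int_R|f_i(y)|\,dy ,$$ and let $\mathcal M^d_{\mathcal R,\alpha}$ be defined in the same way with $\mathcal{DR}$ in place of $\mathcal R$. Let $1<p_1,\dots,p_m<\infty$ and $p_i'=p_i/(p_i-1)$. For an $m$-tuple $\vec\omega=(\omega_1,\dots,\omega_m)$ of nonnegative (finite-valued, measurable) functions on $\mathbb R^n$ put $\nu_{\vec\omega}=\prod_{i=1}^m\omega_i$, and say that $\vec\omega\in A_{(\vec p,q),\mathcal R}$ if $$\sup_{R\in\mathcal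 R}\Big(\frac1{|R|}\int_R\nu_{\vec\omega}^q\,dx\Big)^{\frac1q}\prod_{i=1}^m\Big(\frac1{|R|}\int_R\omega_i^{-p_i'}\,dx\Big)^{\frac1{p_i'}}<\infty ,$$ where $\omega_i^{-p_i'}=\infty$ at the points with $\omega_i=0$, and $0\cdot\infty=0$; let $A^d_{(\vec p,q),\mathcal R}$ be the class defined in the same way with $\mathcal{DR}$ in place of $\mathcal R$. Let $0<\alpha<mn$, $\frac1p=\frac1{p_1}+\cdots+\frac1{p_m}$, and let $p<q<\infty$ satisfy $\frac1q=\frac1p-\frac\alpha n$. Then the following three statements are equivalent: 1. $\vec\omega\in A_{(\vec p,q),\mathcal R}$; 2. there is a constant $C<\infty$ such that $$\big\|\mathcal M_{\mathcal R,\alpha}(\vec f)\big\|_{L^{q,\infty}(\nu_{\vec\omega}^q)}\le C\prod_{i=1}^m\|f_i\|_{L^{p_i}(\omega_i^{p_i})}$$ for all locally integrable $f_i\in L^{p_i}(\omega_i^{p_i})$, $i=1,\dots,m$; 3. there is a constant $C<\infty$ such that $$\big\|\mathcal M_{\mathcal R,\alpha}(\vec f)\big\|_{L^{q}(\nu_{\vec\omega}^q)}\le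 C\prod_{i=1}^m\|f_i\|_{L^{p_i}(\omega_i^{p_i})}$$ for all locally integrable $f_i\in L^{p_i}(\omega_i^{p_i})$, $i=1,\dots,m$. Here $L^q(\nu_{\vec\omega}^q)$ and $L^{p_i}(\omega_i^{p_i})$ are taken with respect to the measures $\nu_{\vec\omega}^q\,dx$ and $\omega_i^{p_i}\,dx$, and $\|g\|_{L^{q,\infty}(\mu)}=\sup_{t>0}t\,\mu(\{|g|>t\})^{1/q}$. The same three-fold equivalence holds with $\mathcal M^d_{\mathcal R,\alpha}$ and $A^d_{(\vec p,q),\mathcal R}$ in place of $\mathcal M_{\mathcal R,\alpha}$ and $A_{(\vec p,q),\mathcal R}$. -/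

import Mathlib

open MeasureTheory
open scoped NNReal ENNReal

namespace StrongMaximal

/-- The family of all rectangles in `ℝⁿ` with sides parallel to the coordinate axes
(nondegenerate and bounded, taken half-open). -/
def rectangles (n : ℕ) : Set (Set (Fin n → ℝ)) :=
  {R | ∃ a b : Fin n → ℝ, (∀ j, a j < b j) ∧ R = Set.univ.pi fun j => Set.Ico (a j) (b j)}

/-- The family of all dyadic rectangles in `ℝⁿ`: products of dyadic intervals
`[l * 2 ^ k, (l + 1) * 2 ^ k)`, `k l ∈ ℤ`, where the side lengths may differ from one coordinate
to another. -/
def dyadicRectangles (n : ℕ) : Set (Set (Fin n → ℝ)) :=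
  {R | ∃ k l : Fin n → ℤ, R = Set.univ.pi fun j =>
    Set.Ico ((l j : ℝ) * (2 : ℝ) ^ (k j)) (((l j : ℝ) + 1) * (2 : ℝ) ^ (k j))}

variable {m n : ℕ}

/-- The multilinear fractional maximal operator over a family `𝓕` of sets:
`sup_{R ∋ x, R ∈ 𝓕} ∏ᵢ |R|^{-(1 - α/(mn))} ∫_R |fᵢ|`. -/
noncomputable def maximalOp (𝓕 : Set (Set (Fin n → ℝ))) (α : ℝ)
    (f : Fin m → (Fin n → ℝ) → ℝ) (x : Fin n → ℝ) : ℝ≥0∞ :=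
  ⨆ R ∈ 𝓕, ⨆ _ : x ∈ R,
    ∏ i, (((volume R) ^ (1 - α / ((m : ℝ) * (n : ℝ))))⁻¹ * ∫⁻ y in R, ‖f i y‖ₑ)

/-- The product weight `ν_ω = ∏ᵢ ωᵢ`. -/
noncomputable def prodWeight (ω : Fin m → (Fin n → ℝ) → ℝ≥0) (x : Fin n → ℝ) : ℝ≥0 :=
  ∏ i, ω i x

/-- The class of multiple weights `A_{(p⃗,q)}` over a family `𝓕` of sets:
`sup_{R ∈ 𝓕} (|R|⁻¹ ∫_R ν_ω^q)^{1/q} ∏ᵢ (|R|⁻¹ ∫_R ωᵢ^{-pᵢ'})^{1/pᵢ'} < ∞`.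
Everything is computed in `[0, ∞]`; in particular `ωᵢ^{-pᵢ'} = ∞` where `ωᵢ = 0`. -/
def MultiWeightClass (𝓕 : Set (Set (Fin n → ℝ))) (p : Fin m → ℝ) (q : ℝ)
    (ω : Fin m → (Fin n → ℝ) → ℝ≥0) : Prop :=
  (⨆ R ∈ 𝓕, (⨍⁻ x in R, (prodWeight ω x : ℝ≥0∞) ^ q ∂volume) ^ (1 / q) *
    ∏ i, (⨍⁻ x in R, (ω i x : ℝ≥0∞) ^ (-(p i).conjExponent) ∂volume) ^
      (1 / (p i).conjExponent)) < ∞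

/-- The measure `w(x)^s dx`. -/
noncomputable def powMeasure (w : (Fin n → ℝ) → ℝ≥0) (s : ℝ) : Measure (Fin n → ℝ) :=
  volume.withDensity fun x => (w x : ℝ≥0∞) ^ s

/-- The weak `L^{q,∞}(μ)` quasi-norm `sup_{t > 0} t μ({g > t})^{1/q}` of a nonnegative
function `g`. -/
noncomputable def weakNorm (g : (Fin n → ℝ) → ℝ≥0∞) (q : ℝ) (μ : Measure (Fin n → ℝ)) : ℝ≥0∞ :=
  ⨆ t : ℝ≥0, (t : ℝ≥0∞) * (μ {x | (t : ℝ≥0∞) < g x}) ^ (1 / q)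

/-- The weak type inequality
`‖M f‖_{L^{q,∞}(ν_ω^q)} ≤ C ∏ᵢ ‖fᵢ‖_{L^{pᵢ}(ωᵢ^{pᵢ})}`, with `C` independent of
the locally integrable functions `fᵢ ∈ L^{pᵢ}(ωᵢ^{pᵢ})`. -/
def WeakBounded (𝓕 : Set (Set (Fin n → ℝ))) (α : ℝ) (p : Fin m → ℝ) (q : ℝ)
    (ω : Fin m → (Fin n → ℝ) → ℝ≥0) : Prop :=
  ∃ C : ℝ≥0, ∀ f : Fin m → (Fin n → ℝ) → ℝ,
    (∀ i, LocallyIntegrable (f i) volume) →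
    (∀ i, MemLp (f i) (ENNReal.ofReal (p i)) (powMeasure (ω i) (p i))) →
    weakNorm (maximalOp 𝓕 α f) q (powMeasure (prodWeight ω) q) ≤
      C * ∏ i, eLpNorm (f i) (ENNReal.ofReal (p i)) (powMeasure (ω i) (p i))

/-- The strong type inequality
`‖M f‖_{L^q(ν_ω^q)} ≤ C ∏ᵢ ‖fᵢ‖_{L^{pᵢ}(ωᵢ^{pᵢ})}`, with `C` independent of
the locally integrable functions `fᵢ ∈ L^{pᵢ}(ωᵢ^{pᵢ})`. -/
def StrongBounded (𝓕 : Set (Set (Fin n → ℝ))) (α : ℝ) (p : Fin m → ℝ) (q : ℝ)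
    (ω : Fin m → (Fin n → ℝ) → ℝ≥0) : Prop :=
  ∃ C : ℝ≥0, ∀ f : Fin m → (Fin n → ℝ) → ℝ,
    (∀ i, LocallyIntegrable (f i) volume) →
    (∀ i, MemLp (f i) (ENNReal.ofReal (p i)) (powMeasure (ω i) (p i))) →
    eLpNorm (maximalOp 𝓕 α f) (ENNReal.ofReal q) (powMeasure (prodWeight ω) q) ≤
      C * ∏ i, eLpNorm (f i) (ENNReal.ofReal (p i)) (powMeasure (ω i) (p i))

end StrongMaximal

/-! Put `σᵢ = ωᵢ^{-pᵢ'}`, `θ = 1/q + ∑ 1/pᵢ' = m - α/n` and `Tᵢ(R) = σᵢ(R)^{-1/pᵢ'} ∫_R |fᵢ|`. The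
weight condition says exactly that the average over `R` defining the maximal function, raised to the
power `q` and multiplied by the `ν_ω^q`-mass of `R`, is at most `K^q ∏ Tᵢ(R)^q`
(`MultiWeightBound.rpow_mul_prodMass_le`). No covering argument is used: the supremum over dyadic
rectangles is replaced by the sum over all of them, Hölder with exponents `p₀/pᵢ` separates the
factors, and it remains to bound `∑_R Tᵢ(R)^{pᵢ s}` by `‖fᵢ‖^{pᵢ s}`, where `s = q/p₀ > 1`.

That sum converges for two reasons. When `R` is halved in one coordinate into `R₁` and `R₂`, Hölder
gives `T(R)^p ≤ T(R₁)^p + T(R₂)^p`; and since the weight condition makes `σᵢ` doubling under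
halving, `T(R) ≤ γ (T(R₁) + T(R₂))` with `γ < 1`. So from one generation to the next the sum of
`T^{ps}` contracts, except where both halves contribute comparably; there the superadditivity of `x
↦ x^s` is strict, and the excess is paid for by a bounded telescoping quantity
(`exists_tsum_dyadic_interval_le`). Minkowski's inequality carries the one-parameter estimate to `n`
parameters by induction.

An arbitrary rectangle lies in a union of `2^n` congruent dyadic ones of comparable volume, so a
countable family again suffices. Conversely, the weak type inequality tested on truncations of `σᵢ
1_R` returns the weight condition, and strong type implies weak type by Chebyshev once the maximal
function is known to be measurable. -/

namespace StrongMaximal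

/-! ### Inequalities for powers and sums in `[0, ∞]` -/

/-- Minkowski's inequality for iterated sums in `[0, ∞]`. -/
theorem tsum_rpow_tsum_le {ι κ : Type*} [Countable κ] {s : ℝ} (hs : 1 ≤ s) (g : ι → κ → ℝ≥0∞) :
    (∑' y, (∑' x, g x y) ^ s) ^ (1 / s) ≤ ∑' x, (∑' y, g x y ^ s) ^ (1 / s) := by
  have s0 : 0 < s := by linarith
  let : MeasurableSpace κ := ⊤
  have fin : ∀ t : Finset ι, (∑' y, (∑ x ∈ t, g x y) ^ s) ^ (1 / s) ≤
      ∑ x ∈ t, (∑' y, g x y ^ s) ^ (1 / s) := by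
    intro t
    classical
    induction t using Finset.induction_on with
    | empty => simp [s0]
    | insert a t ha ih =>
      simp only [Finset.sum_insert ha]
      refine le_trans ?_ (add_le_add le_rfl ih)
      have := ENNReal.lintegral_Lp_add_le (μ := Measure.count) (f := g a)
        (g := fun y => ∑ x ∈ t, g x y) (by fun_prop) (by fun_prop) hs
      simpa [lintegral_count] using this
  rw [one_div, ENNReal.rpow_inv_le_iff s0, ENNReal.tsum_eq_iSup_sum]
  refine iSup_le fun u => ?_
  have key : ∑ y ∈ u, (∑' x, g x y) ^ s = ⨆ t : Finset ι, ∑ y ∈ u, (∑ x ∈ t, g x y) ^ s := by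
    rw [← ENNReal.finsetSum_iSup_of_monotone]
    · refine Finset.sum_congr rfl fun y _ => ?_
      rw [ENNReal.tsum_eq_iSup_sum]
      exact (ENNReal.orderIsoRpow s s0).map_iSup _
    · intro y t t' h
      exact ENNReal.rpow_le_rpow (Finset.sum_le_sum_of_subset h) s0.le
  rw [key]
  refine iSup_le fun t => ?_
  rw [← ENNReal.rpow_inv_le_iff s0, ← one_div]
  calc _ ≤ (∑' y, (∑ x ∈ t, g x y) ^ s) ^ (1 / s) := by
        gcongr; exact ENNReal.sum_le_tsum u
    _ ≤ _ := fin t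
    _ ≤ _ := by
      rw [one_div]
      exact ENNReal.sum_le_tsum (f := fun x => (∑' y, g x y ^ s) ^ s⁻¹) t

/-- Quantitative superadditivity of `x ↦ x ^ s` for `s > 1`. -/
theorem rpow_add_rpow_add_min_le {s : ℝ} (hs : 1 < s) (x y : ℝ≥0∞) :
    x ^ s + y ^ s + ((2 : ℝ≥0∞) ^ (s - 1) - 1) * min x y ^ s ≤ (x + y) ^ s := by
  wlog h : y ≤ x generalizing x y
  · have := this y x (le_of_not_ge h)
    rwa [min_comm, add_comm (y ^ s), add_comm y x] at this
  rw [min_eq_right h, add_assoc]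
  have one : (1 : ℝ≥0∞) ≤ 2 ^ (s - 1) := ENNReal.one_le_rpow (by norm_num) (by linarith)
  have e1 : y ^ s + ((2 : ℝ≥0∞) ^ (s - 1) - 1) * y ^ s = y * (2 * y) ^ (s - 1) := by
    nth_rewrite 1 [← one_mul (y ^ s)]
    rw [← add_mul, add_tsub_cancel_of_le one, ENNReal.mul_rpow_of_nonneg _ _ (by linarith)]
    rw [show y ^ s = y ^ (1 + (s - 1)) by ring_nf,
      ENNReal.rpow_add_of_nonneg _ _ (by norm_num) (by linarith), ENNReal.rpow_one]
    ring
  have e2 : ∀ z : ℝ≥0∞, z ^ s = z * z ^ (s - 1) := by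
    intro z
    rw [show z ^ s = z ^ (1 + (s - 1)) by ring_nf,
      ENNReal.rpow_add_of_nonneg _ _ (by norm_num) (by linarith), ENNReal.rpow_one]
  rw [e1, e2 x, e2 (x + y), add_mul]
  have hs' : 0 ≤ s - 1 := by linarith
  refine add_le_add (mul_le_mul_right (ENNReal.rpow_le_rpow le_self_add hs') _)
    (mul_le_mul_right (ENNReal.rpow_le_rpow ?_ hs') _)
  rw [two_mul]
  exact add_le_add h le_rfl

/-- Either the smaller number is a small fraction `δ` of the larger, and `γ (1 + δ) < 1` still gives
a contraction, or the two are comparable and the minimum controls everything. -/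
theorem exists_rpow_add_le {γ : ℝ≥0} (hγ : γ < 1) {q : ℝ} (hq : 0 < q) :
    ∃ ρ B : ℝ≥0, ρ < 1 ∧ ∀ x y : ℝ≥0∞,
      (γ * (x + y)) ^ q ≤ ρ * (x ^ q + y ^ q) + B * min x y ^ q := by
  set δ : ℝ≥0 := (1 - γ) / 2 with hδ
  have δ0 : 0 < δ := by
    have : 0 < 1 - γ := tsub_pos_of_lt hγ
    positivity
  have hlt : γ * (1 + δ) < 1 := by
    rw [← NNReal.coe_lt_coe]
    have : (δ : ℝ) = (1 - γ) / 2 := by simp [hδ, NNReal.coe_sub hγ.le]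
    have h1 : (γ : ℝ) < 1 := hγ
    have h0 : (0 : ℝ) ≤ γ := γ.2
    push_cast
    rw [this]
    nlinarith
  refine ⟨(γ * (1 + δ)) ^ q, (γ * (1 + δ⁻¹)) ^ q, NNReal.rpow_lt_one hlt hq, ?_⟩
  intro x y
  wlog h : y ≤ x generalizing x y
  · have := this y x (le_of_not_ge h)
    rwa [min_comm, add_comm (y ^ q), add_comm y x] at this
  rw [min_eq_right h]
  push_cast [ENNReal.coe_rpow_of_nonneg _ hq.le]
  rw [mul_add ((_ : ℝ≥0∞) ^ q), ← ENNReal.mul_rpow_of_nonneg _ _ hq.le,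
    ← ENNReal.mul_rpow_of_nonneg _ _ hq.le, ← ENNReal.mul_rpow_of_nonneg _ _ hq.le]
  rcases le_total y (δ * x) with h1 | h1
  · refine le_trans ?_ (le_trans le_self_add le_self_add)
    rw [mul_assoc, add_mul, one_mul]
    gcongr
  · refine le_trans ?_ le_add_self
    rw [mul_assoc, add_mul, one_mul, add_comm]
    gcongr
    rw [ENNReal.coe_inv δ0.ne', mul_comm, ← div_eq_mul_inv, ENNReal.le_div_iff_mul_le]
    · rwa [mul_comm]
    · simp [δ0.ne']
    · simp

theorem tsum_int_even_add_odd (g : ℤ → ℝ≥0∞) :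
    ∑' l, (g (2 * l) + g (2 * l + 1)) = ∑' l, g l := by
  have h0 : Function.Injective fun l : ℤ => 2 * l := fun a b h => by simpa using h
  have h1 : Function.Injective fun l : ℤ => 2 * l + 1 := fun a b h => by simpa using h
  have hc : IsCompl (Set.range fun l : ℤ => 2 * l) (Set.range fun l : ℤ => 2 * l + 1) := by
    have he : (Set.range fun l : ℤ => 2 * l) = {l | Even l} := by
      ext x; simp [even_iff_exists_two_mul]
    have ho : (Set.range fun l : ℤ => 2 * l + 1) = {l | Odd l} := by
      ext x; simp [Odd]
    rw [he, ho]
    exact Int.isCompl_even_odd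
  rw [ENNReal.tsum_add]
  exact (((h0.hasSum_range_iff).2 (ENNReal.summable.hasSum)).add_isCompl hc
    ((h1.hasSum_range_iff).2 (ENNReal.summable.hasSum))).tsum_eq.symm

theorem tsum_rpow_le_rpow_tsum {ι : Type*} {s : ℝ} (hs : 1 ≤ s) (g : ι → ℝ≥0∞) :
    ∑' i, g i ^ s ≤ (∑' i, g i) ^ s := by
  rw [ENNReal.tsum_eq_iSup_sum]
  refine iSup_le fun t => le_trans ?_ (ENNReal.rpow_le_rpow (ENNReal.sum_le_tsum t) (by linarith))
  classical
  induction t using Finset.induction_on with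
  | empty => simp
  | insert a t ha ih =>
    rw [Finset.sum_insert ha, Finset.sum_insert ha]
    exact (add_le_add le_rfl ih).trans (ENNReal.add_rpow_le_rpow_add _ _ hs)

/-! ### Embedding estimates over dyadic intervals and rectangles -/

/-- An embedding estimate for functions on the dyadic intervals of the line of length at
least one, the interval `[l * 2 ^ j, (l + 1) * 2 ^ j)` being encoded as `(j, l)`. -/
theorem exists_tsum_dyadic_interval_le {γ : ℝ≥0} (hγ : γ < 1) {p s : ℝ} (hp : 0 < p)
    (hs : 1 < s) :
    ∃ C : ℝ≥0, ∀ T : ℕ → ℤ → ℝ≥0∞,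
      (∀ j l, T (j + 1) l ≤ γ * (T j (2 * l) + T j (2 * l + 1))) →
      (∀ j l, T (j + 1) l ^ p ≤ T j (2 * l) ^ p + T j (2 * l + 1) ^ p) →
      ∑' j, ∑' l, T j l ^ (p * s) ≤ C * (∑' l, T 0 l ^ p) ^ s := by
  have s0 : 0 < s := by linarith
  obtain ⟨ρ, B, hρ, hB⟩ := exists_rpow_add_le hγ (mul_pos hp s0)
  set c : ℝ≥0 := 2 ^ (s - 1) - 1 with hc
  have c0 : c ≠ 0 := by
    have : (1 : ℝ≥0) < 2 ^ (s - 1) := NNReal.one_lt_rpow (by norm_num) (by linarith)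
    exact (tsub_pos_of_lt this).ne'
  have cE : (c : ℝ≥0∞) = 2 ^ (s - 1) - 1 := by
    rw [hc, ENNReal.coe_sub, ENNReal.coe_rpow_of_nonneg _ (by linarith)]; simp
  -- `(1 - ρ)⁻¹` comes from absorbing the contracted sum; `B / c` is the price of the comparable
  -- pairs in units of the superadditivity gain.
  refine ⟨(1 - ρ)⁻¹ * (1 + B / c), fun T h1 h2 => ?_⟩
  set A := ∑' l, T 0 l ^ p with hA
  by_cases hAtop : A = ∞
  · rw [hAtop, ENNReal.top_rpow_of_pos s0, ENNReal.mul_top]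
    · exact le_top
    · have : 0 < 1 - ρ := tsub_pos_of_lt hρ
      exact_mod_cast (by positivity : (1 - ρ)⁻¹ * (1 + B / c) ≠ 0)
  -- `Φ` is the additive function on the tree that agrees with `T ^ p` on the finest level. It
  -- majorizes `T ^ p`, and its total mass is `A` on every level.
  let Φ : ℕ → ℤ → ℝ≥0∞ := fun j => Nat.rec (fun l => T 0 l ^ p)
    (fun _ φ l => φ (2 * l) + φ (2 * l + 1)) j
  have Φs : ∀ j l, Φ (j + 1) l = Φ j (2 * l) + Φ j (2 * l + 1) := fun j l => rfl
  have Φsum : ∀ j, ∑' l, Φ j l = A := by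
    intro j
    induction j with
    | zero => rfl
    | succ j ih => simp_rw [Φs, tsum_int_even_add_odd, ih]
  have TΦ : ∀ j l, T j l ^ p ≤ Φ j l := by
    intro j
    induction j with
    | zero => intro l; exact le_rfl
    | succ j ih => intro l; exact (h2 j l).trans (add_le_add (ih _) (ih _))
  have TΦ' : ∀ j l, T j l ^ (p * s) ≤ Φ j l ^ s := by
    intro j l
    rw [ENNReal.rpow_mul]
    exact ENNReal.rpow_le_rpow (TΦ j l) s0.le
  set S : ℕ → ℝ≥0∞ := fun j => ∑' l, T j l ^ (p * s) with hS
  set P : ℕ → ℝ≥0∞ := fun j => ∑' l, Φ j l ^ s with hP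
  have PA : ∀ j, P j ≤ A ^ s := by
    intro j
    rw [← Φsum j]
    exact tsum_rpow_le_rpow_tsum hs.le _
  have SA : ∀ j, S j ≤ A ^ s := fun j => (ENNReal.tsum_le_tsum (TΦ' j)).trans (PA j)
  set b : ℝ≥0∞ := ((B / c : ℝ≥0) : ℝ≥0∞) with hb
  have bc : b * c = B := by
    rw [hb, ← ENNReal.coe_mul, div_mul_cancel₀ _ c0]
  -- This is `S (j + 1) ≤ ρ * S j + b * (P (j + 1) - P j)` without subtraction: the minimum term is
  -- dominated by the gain of `Φ ^ s` when two siblings merge.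
  have step : ∀ j, S (j + 1) + b * P j ≤ ρ * S j + b * P (j + 1) := by
    intro j
    simp only [hS, hP]
    rw [← tsum_int_even_add_odd (fun l => Φ j l ^ s), ← tsum_int_even_add_odd (fun l => T j l ^ _),
      ← ENNReal.tsum_mul_left, ← ENNReal.tsum_mul_left, ← ENNReal.tsum_mul_left,
      ← ENNReal.tsum_add, ← ENNReal.tsum_add]
    refine ENNReal.tsum_le_tsum fun l => ?_
    have e1 := (ENNReal.rpow_le_rpow (h1 j l) (mul_pos hp s0).le).trans (hB _ _)
    have e2 := rpow_add_rpow_add_min_le hs (Φ j (2 * l)) (Φ j (2 * l + 1))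
    have e3 : min (T j (2 * l)) (T j (2 * l + 1)) ^ (p * s) ≤
        min (Φ j (2 * l)) (Φ j (2 * l + 1)) ^ s := by
      rcases min_cases (Φ j (2 * l)) (Φ j (2 * l + 1)) with h | h
      · rw [h.1]
        exact (ENNReal.rpow_le_rpow (min_le_left _ _) (mul_pos hp s0).le).trans (TΦ' _ _)
      · rw [h.1]
        exact (ENNReal.rpow_le_rpow (min_le_right _ _) (mul_pos hp s0).le).trans (TΦ' _ _)
    rw [← cE] at e2
    rw [Φs]
    calc _ ≤ ρ * (T j (2 * l) ^ (p * s) + T j (2 * l + 1) ^ (p * s)) +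
          B * min (Φ j (2 * l)) (Φ j (2 * l + 1)) ^ s +
          b * (Φ j (2 * l) ^ s + Φ j (2 * l + 1) ^ s) := by
          gcongr
          exact e1.trans (by gcongr)
      _ = ρ * (T j (2 * l) ^ (p * s) + T j (2 * l + 1) ^ (p * s)) +
          b * (Φ j (2 * l) ^ s + Φ j (2 * l + 1) ^ s +
            c * min (Φ j (2 * l)) (Φ j (2 * l + 1)) ^ s) := by
          rw [← bc]; ring
      _ ≤ _ := by gcongr
  have tele : ∀ M, ∑ j ∈ Finset.range (M + 1), S j + b * P 0 ≤
      S 0 + ρ * ∑ j ∈ Finset.range M, S j + b * P M := by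
    intro M
    induction M with
    | zero => simp
    | succ M ih =>
      rw [Finset.sum_range_succ _ (M + 1), Finset.sum_range_succ _ M, mul_add]
      rw [Finset.sum_range_succ _ M] at ih
      calc _ = (∑ j ∈ Finset.range M, S j + S M + b * P 0) + S (M + 1) := by ring
        _ ≤ (S 0 + ρ * ∑ j ∈ Finset.range M, S j + b * P M) + S (M + 1) := by gcongr
        _ = S 0 + ρ * ∑ j ∈ Finset.range M, S j + (S (M + 1) + b * P M) := by ring
        _ ≤ S 0 + ρ * ∑ j ∈ Finset.range M, S j + (ρ * S M + b * P (M + 1)) := by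
          exact add_le_add le_rfl (step M)
        _ = _ := by ring
  have As : A ^ s ≠ ∞ := ENNReal.rpow_ne_top_of_nonneg s0.le hAtop
  rw [ENNReal.tsum_eq_iSup_nat]
  refine iSup_le fun M => ?_
  set X := ∑ j ∈ Finset.range (M + 1), S j with hX
  -- Finiteness of the partial sum is what allows `ρ * X` to be absorbed on the left.
  have Xtop : X ≠ ∞ := by
    rw [hX]
    exact ENNReal.sum_ne_top.2 fun j _ => ((SA j).trans_lt As.lt_top).ne
  have hXle : X ≤ ρ * X + (1 + b) * A ^ s := by
    calc X ≤ X + b * P 0 := le_self_add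
      _ ≤ _ := tele M
      _ ≤ A ^ s + ρ * X + b * A ^ s := by
        refine add_le_add (add_le_add (SA 0) (mul_le_mul_right ?_ _)) (mul_le_mul_right (PA M) _)
        exact Finset.sum_le_sum_of_subset (Finset.range_subset_range.2 M.le_succ)
      _ = _ := by ring
  have : (∑ j ∈ Finset.range M, S j) ≤ X := Finset.sum_le_sum_of_subset 
    (Finset.range_subset_range.2 M.le_succ)
  refine this.trans ?_
  lift X to ℝ≥0 using Xtop with X'
  lift A ^ s to ℝ≥0 using As with A'
  rw [hb] at hXle
  norm_cast at hXle ⊢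
  have h3 : (1 - ρ) * X' ≤ (1 + B / c) * A' := by
    rw [tsub_mul, one_mul]
    exact tsub_le_iff_left.2 hXle
  have h4 : 0 < 1 - ρ := tsub_pos_of_lt hρ
  calc X' = (1 - ρ)⁻¹ * ((1 - ρ) * X') := by rw [inv_mul_cancel_left₀ h4.ne']
    _ ≤ (1 - ρ)⁻¹ * ((1 + B / c) * A') := by gcongr
    _ = _ := by ring

theorem tsum_fin_cons {n : ℕ} {β : Type*} (g : (Fin (n + 1) → β) → ℝ≥0∞) :
    ∑' k, g k = ∑' x, ∑' k, g (Fin.cons x k) := by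
  rw [← (Fin.consEquiv fun _ => β).tsum_eq, ENNReal.tsum_prod']
  rfl

/-- An embedding estimate for functions on the dyadic rectangles of side lengths at least one,
the rectangle `∏ᵢ [lᵢ * 2 ^ kᵢ, (lᵢ + 1) * 2 ^ kᵢ)` being encoded as `(k, l)`. -/
theorem exists_tsum_dyadic_rectangle_le {γ : ℝ≥0} (hγ : γ < 1) {p s : ℝ} (hp : 0 < p)
    (hs : 1 < s) (n : ℕ) :
    ∃ C : ℝ≥0, ∀ T : (Fin n → ℕ) → (Fin n → ℤ) → ℝ≥0∞,
      (∀ i k l, T (Function.update k i (k i + 1)) l ≤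
        γ * (T k (Function.update l i (2 * l i)) + T k (Function.update l i (2 * l i + 1)))) →
      (∀ i k l, T (Function.update k i (k i + 1)) l ^ p ≤
        T k (Function.update l i (2 * l i)) ^ p + T k (Function.update l i (2 * l i + 1)) ^ p) →
      ∑' k, ∑' l, T k l ^ (p * s) ≤ C * (∑' l, T 0 l ^ p) ^ s := by
  have s0 : 0 < s := by linarith
  obtain ⟨C₁, hC₁⟩ := exists_tsum_dyadic_interval_le hγ hp hs
  induction n with
  | zero =>
    refine ⟨1, fun T _ _ => ?_⟩
    rw [tsum_eq_single default (by intro b hb; exact absurd (Subsingleton.elim _ _) hb),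
      tsum_eq_single default (by intro b hb; exact absurd (Subsingleton.elim _ _) hb),
      tsum_eq_single default (by intro b hb; exact absurd (Subsingleton.elim _ _) hb),
      Subsingleton.elim (0 : Fin 0 → ℕ) default, ENNReal.rpow_mul, ENNReal.coe_one, one_mul]
  | succ n ih =>
    obtain ⟨C, hC⟩ := ih
    refine ⟨C₁ * C, fun T h1 h2 => ?_⟩
    -- The one-parameter estimate in the first coordinate leaves only its finest scale, which is
    -- `g`. Minkowski then moves the sum over `l₀` outside, where the induction hypothesis applies
    -- to each slice.
    set g : ℤ → (Fin n → ℕ) × (Fin n → ℤ) → ℝ≥0∞ := fun l₀ y =>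
      T (Fin.cons 0 y.1) (Fin.cons l₀ y.2) ^ p with hg
    have slice : ∀ l₀, (∑' y, g l₀ y ^ s) ^ (1 / s) ≤
        (C : ℝ≥0∞) ^ (1 / s) * ∑' l, T 0 (Fin.cons l₀ l) ^ p := by
      intro l₀
      rw [one_div, ENNReal.rpow_inv_le_iff s0, ENNReal.mul_rpow_of_nonneg _ _ s0.le,
        ENNReal.rpow_inv_rpow s0.ne', ENNReal.tsum_prod']
      simp only [hg, ← ENNReal.rpow_mul]
      have z : (0 : Fin (n + 1) → ℕ) = Fin.cons 0 0 := by
        ext i; refine Fin.cases ?_ (fun i => ?_) i <;> simp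
      rw [z]
      refine hC (fun k l => T (Fin.cons 0 k) (Fin.cons l₀ l)) (fun i k l => ?_) fun i k l => ?_
      · simpa only [Fin.cons_update, Fin.cons_succ] using
          h1 i.succ (Fin.cons 0 k) (Fin.cons l₀ l)
      · simpa only [Fin.cons_update, Fin.cons_succ] using
          h2 i.succ (Fin.cons 0 k) (Fin.cons l₀ l)
    calc ∑' k, ∑' l, T k l ^ (p * s)
        = ∑' y : (Fin n → ℕ) × (Fin n → ℤ), ∑' k₀, ∑' l₀,
            T (Fin.cons k₀ y.1) (Fin.cons l₀ y.2) ^ (p * s) := by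
          simp_rw [tsum_fin_cons]
          rw [ENNReal.tsum_comm, ENNReal.tsum_prod']
          refine tsum_congr fun k => ?_
          rw [ENNReal.tsum_comm (α := Fin n → ℤ)]
          exact tsum_congr fun k₀ => ENNReal.tsum_comm
      _ ≤ ∑' y, C₁ * (∑' l₀, g l₀ y) ^ s := by
          refine ENNReal.tsum_le_tsum fun y => ?_
          refine hC₁ (fun k₀ l₀ => T (Fin.cons k₀ y.1) (Fin.cons l₀ y.2)) (fun k₀ l₀ => ?_)
            fun k₀ l₀ => ?_
          · simpa only [Fin.update_cons_zero, Fin.cons_zero] using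
              h1 0 (Fin.cons k₀ y.1) (Fin.cons l₀ y.2)
          · simpa only [Fin.update_cons_zero, Fin.cons_zero] using
              h2 0 (Fin.cons k₀ y.1) (Fin.cons l₀ y.2)
      _ = C₁ * ((∑' y, (∑' l₀, g l₀ y) ^ s) ^ (1 / s)) ^ s := by
          rw [ENNReal.tsum_mul_left, one_div, ENNReal.rpow_inv_rpow s0.ne']
      _ ≤ C₁ * (∑' l₀, (C : ℝ≥0∞) ^ (1 / s) * ∑' l, T 0 (Fin.cons l₀ l) ^ p) ^ s := by
          gcongr
          exact (tsum_rpow_tsum_le hs.le g).trans (ENNReal.tsum_le_tsum slice)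
      _ = _ := by
          rw [ENNReal.tsum_mul_left, ENNReal.mul_rpow_of_nonneg _ _ s0.le, one_div,
            ENNReal.rpow_inv_rpow s0.ne', ← tsum_fin_cons fun l => T 0 l ^ p]
          push_cast
          ring

/-- The estimate `exists_tsum_dyadic_rectangle_le` over dyadic rectangles of all side lengths. -/
theorem exists_tsum_all_dyadic_rectangle_le {γ : ℝ≥0} (hγ : γ < 1) {p s : ℝ} (hp : 0 < p)
    (hs : 1 < s) (n : ℕ) :
    ∃ C : ℝ≥0, ∀ (T : (Fin n → ℤ) → (Fin n → ℤ) → ℝ≥0∞) (A : ℝ≥0∞),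
      (∀ i k l, T (Function.update k i (k i + 1)) l ≤
        γ * (T k (Function.update l i (2 * l i)) + T k (Function.update l i (2 * l i + 1)))) →
      (∀ i k l, T (Function.update k i (k i + 1)) l ^ p ≤
        T k (Function.update l i (2 * l i)) ^ p + T k (Function.update l i (2 * l i + 1)) ^ p) →
      (∀ k, ∑' l, T k l ^ p ≤ A) →
      ∑' k, ∑' l, T k l ^ (p * s) ≤ C * A ^ s := by
  obtain ⟨C, hC⟩ := exists_tsum_dyadic_rectangle_le hγ hp hs n
  refine ⟨C, fun T A h1 h2 h3 => ?_⟩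
  rw [ENNReal.tsum_eq_iSup_sum]
  refine iSup_le fun t => ?_
  -- Finitely many scales have a common lower bound `N`; scales counted from `N` are natural
  -- numbers, and the bound does not depend on `N` because `A` controls every scale.
  obtain ⟨N, hN⟩ : ∃ N : ℤ, ∀ k ∈ t, ∀ i, N ≤ k i := by
    obtain ⟨b, hb⟩ := t.bddBelow
    refine ⟨-∑ i, |b i|, fun k hk i => ?_⟩
    have e1 : b i ≤ k i := hb hk i
    have e2 : |b i| ≤ ∑ i, |b i| :=
      Finset.single_le_sum (f := fun i => |b i|) (fun i _ => abs_nonneg _) (Finset.mem_univ i)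
    have := neg_abs_le (b i)
    linarith
  set T' : (Fin n → ℕ) → (Fin n → ℤ) → ℝ≥0∞ := fun k l => T (fun i => N + k i) l with hT'
  have upd : ∀ (k : Fin n → ℕ) i, (fun j => N + ((Function.update k i (k i + 1)) j : ℤ)) =
      Function.update (fun j => N + (k j : ℤ)) i ((fun j => N + (k j : ℤ)) i + 1) := by
    intro k i
    ext j
    by_cases h : j = i
    · subst h; simp [add_assoc]
    · simp [h]
  have main := hC T' (fun i k l => by simpa only [hT', upd] using h1 i (fun j => N + k j) l)
    (fun i k l => by simpa only [hT', upd] using h2 i (fun j => N + k j) l)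
  refine le_trans ?_ (main.trans (mul_le_mul_right (ENNReal.rpow_le_rpow (h3 _) (by linarith)) _))
  let φ : (Fin n → ℤ) → (Fin n → ℕ) := fun k i => (k i - N).toNat
  have hφ : ∀ k ∈ t, (fun i => N + (φ k i : ℤ)) = k := by
    intro k hk
    ext i
    have := hN k hk i
    simp only [φ]
    omega
  have inj : Set.InjOn φ t := by
    intro k hk k' hk' h
    rw [← hφ k hk, ← hφ k' hk', h]
  calc ∑ k ∈ t, ∑' l, T k l ^ (p * s) = ∑ k ∈ t, ∑' l, T' (φ k) l ^ (p * s) := by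
        refine Finset.sum_congr rfl fun k hk => ?_
        simp only [hT', hφ k hk]
    _ = ∑ k ∈ t.image φ, ∑' l, T' k l ^ (p * s) :=
        (Finset.sum_image (f := fun k => ∑' l, T' k l ^ (p * s)) inj).symm
    _ ≤ _ := ENNReal.sum_le_tsum _

/-! ### Geometry of dyadic rectangles -/

variable {m n : ℕ}

/-- The rectangle `∏ⱼ [lⱼ * 2 ^ kⱼ, (lⱼ + e) * 2 ^ kⱼ)`, a union of `e ^ n` dyadic rectangles. -/
def dyadicBox (e : ℕ) (k l : Fin n → ℤ) : Set (Fin n → ℝ) :=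
  Set.univ.pi fun j =>
    Set.Ico ((l j : ℝ) * (2 : ℝ) ^ (k j)) (((l j : ℝ) + e) * (2 : ℝ) ^ (k j))

theorem mem_dyadicBox {e : ℕ} {k l : Fin n → ℤ} {x : Fin n → ℝ} :
    x ∈ dyadicBox e k l ↔
      ∀ j, (l j : ℝ) * (2 : ℝ) ^ (k j) ≤ x j ∧ x j < ((l j : ℝ) + e) * (2 : ℝ) ^ (k j) := by
  simp [dyadicBox, Set.mem_pi]

theorem measurableSet_dyadicBox (e : ℕ) (k l : Fin n → ℤ) : MeasurableSet (dyadicBox e k l) :=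
  MeasurableSet.univ_pi fun _ => measurableSet_Ico

theorem volume_dyadicBox (e : ℕ) (k l : Fin n → ℤ) :
    volume (dyadicBox e k l) = ∏ j, ENNReal.ofReal (e * (2 : ℝ) ^ (k j)) := by
  rw [dyadicBox, Real.volume_pi_Ico]
  refine Finset.prod_congr rfl fun j _ => ?_
  congr 1
  ring

theorem mem_dyadicRectangles {R : Set (Fin n → ℝ)} :
    R ∈ dyadicRectangles n ↔ ∃ k l, R = dyadicBox 1 k l := by
  simp [dyadicRectangles, dyadicBox]

theorem dyadicBox_mem_dyadicRectangles (k l : Fin n → ℤ) :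
    dyadicBox 1 k l ∈ dyadicRectangles n :=
  mem_dyadicRectangles.2 ⟨k, l, rfl⟩

theorem dyadicBox_mem_rectangles {e : ℕ} (he : 0 < e) (k l : Fin n → ℤ) :
    dyadicBox e k l ∈ rectangles n := by
  refine ⟨_, _, fun j => ?_, rfl⟩
  have : (0 : ℝ) < 2 ^ k j := by positivity
  have : (0 : ℝ) < e := by exact_mod_cast he
  gcongr
  linarith

theorem dyadicRectangles_subset_rectangles : dyadicRectangles n ⊆ rectangles n := by
  intro R hR
  obtain ⟨k, l, rfl⟩ := mem_dyadicRectangles.1 hR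
  exact dyadicBox_mem_rectangles one_pos k l

theorem measurableSet_of_mem_rectangles {R : Set (Fin n → ℝ)} (hR : R ∈ rectangles n) :
    MeasurableSet R := by
  obtain ⟨a, b, -, rfl⟩ := hR
  exact MeasurableSet.univ_pi fun _ => measurableSet_Ico

theorem volume_ne_zero_of_mem_rectangles {R : Set (Fin n → ℝ)} (hR : R ∈ rectangles n) :
    volume R ≠ 0 := by
  obtain ⟨a, b, h, rfl⟩ := hR
  rw [Real.volume_pi_Ico, Finset.prod_ne_zero_iff]
  intro j _
  simpa using h j

theorem volume_ne_top_of_mem_rectangles {R : Set (Fin n → ℝ)} (hR : R ∈ rectangles n) :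
    volume R ≠ ∞ := by
  obtain ⟨a, b, h, rfl⟩ := hR
  rw [Real.volume_pi_Ico]
  exact ENNReal.prod_ne_top fun j _ => ENNReal.ofReal_ne_top

theorem two_zpow_add_one (k : ℤ) : (2 : ℝ) ^ (k + 1) = 2 * 2 ^ k := by
  rw [zpow_add_one₀ two_ne_zero, mul_comm]

theorem dyadicBox_eq_union (i : Fin n) (k l : Fin n → ℤ) :
    dyadicBox 1 (Function.update k i (k i + 1)) l =
      dyadicBox 1 k (Function.update l i (2 * l i)) ∪
        dyadicBox 1 k (Function.update l i (2 * l i + 1)) := by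
  have c0 : (0 : ℝ) < 2 ^ k i := by positivity
  ext x
  simp only [Set.mem_union, mem_dyadicBox]
  constructor
  · intro h
    have hi := h i
    simp only [Function.update_self, two_zpow_add_one, Nat.cast_one] at hi
    have hj : ∀ j, j ≠ i → (l j : ℝ) * (2 : ℝ) ^ (k j) ≤ x j ∧
        x j < ((l j : ℝ) + (1 : ℕ)) * (2 : ℝ) ^ (k j) := by
      intro j hj
      have := h j
      rwa [Function.update_of_ne hj] at this
    rcases lt_or_ge (x i) ((2 * l i + 1) * 2 ^ k i) with hx | hx
    · left
      intro j
      by_cases e : j = i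
      · subst e
        simp only [Function.update_self]
        push_cast
        exact ⟨by nlinarith, hx⟩
      · simpa only [Function.update_of_ne e] using hj j e
    · right
      intro j
      by_cases e : j = i
      · subst e
        simp only [Function.update_self]
        push_cast
        exact ⟨hx, by nlinarith⟩
      · simpa only [Function.update_of_ne e] using hj j e
  · rintro (h | h) <;> intro j <;> have hj := h j <;> by_cases e : j = i
    · subst e
      simp only [Function.update_self, two_zpow_add_one] at hj ⊢
      push_cast at hj ⊢
      exact ⟨by nlinarith, by nlinarith⟩
    · simpa only [Function.update_of_ne e] using hj
    · subst e
      simp only [Function.update_self, two_zpow_add_one] at hj ⊢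
      push_cast at hj ⊢
      exact ⟨by nlinarith, by nlinarith⟩
    · simpa only [Function.update_of_ne e] using hj

theorem disjoint_dyadicBox (k : Fin n → ℤ) {l l' : Fin n → ℤ} (h : l ≠ l') :
    Disjoint (dyadicBox 1 k l) (dyadicBox 1 k l') := by
  rw [Set.disjoint_left]
  intro x hx hx'
  refine h (funext fun j => ?_)
  have h1 := mem_dyadicBox.1 hx j
  have h2 := mem_dyadicBox.1 hx' j
  have c0 : (0 : ℝ) < 2 ^ k j := by positivity
  have e1 : (l j : ℝ) < (l' j : ℝ) + (1 : ℕ) := lt_of_mul_lt_mul_right (h1.1.trans_lt h2.2) c0.le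
  have e2 : (l' j : ℝ) < (l j : ℝ) + (1 : ℕ) := lt_of_mul_lt_mul_right (h2.1.trans_lt h1.2) c0.le
  norm_cast at e1 e2
  omega

theorem volume_dyadicBox_update (i : Fin n) (k l l' : Fin n → ℤ) :
    volume (dyadicBox 1 (Function.update k i (k i + 1)) l) = 2 * volume (dyadicBox 1 k l') := by
  rw [volume_dyadicBox, volume_dyadicBox, ← Finset.mul_prod_erase _ _ (Finset.mem_univ i),
    ← Finset.mul_prod_erase _ _ (Finset.mem_univ i), ← mul_assoc]
  congr 1
  · rw [Function.update_self, two_zpow_add_one, ← ENNReal.ofReal_ofNat 2,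
      ← ENNReal.ofReal_mul zero_le_two]
    congr 1
    ring
  · refine Finset.prod_congr rfl fun j hj => ?_
    rw [Function.update_of_ne (Finset.ne_of_mem_erase hj)]

theorem dyadicBox_eq_iUnion (e : ℕ) (k l : Fin n → ℤ) :
    dyadicBox e k l = ⋃ ε : Fin n → Fin e, dyadicBox 1 k (fun j => l j + (ε j : ℤ)) := by
  ext x
  rw [Set.mem_iUnion]
  simp only [mem_dyadicBox]
  constructor
  · intro h
    have hf : ∀ j, ∃ ε : Fin e, ((l j + (ε : ℤ) : ℤ) : ℝ) * (2 : ℝ) ^ (k j) ≤ x j ∧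
        x j < (((l j + (ε : ℤ) : ℤ) : ℝ) + (1 : ℕ)) * (2 : ℝ) ^ (k j) := by
      intro j
      obtain ⟨h1, h2⟩ := h j
      have c0 : (0 : ℝ) < 2 ^ k j := by positivity
      rw [← le_div_iff₀ c0] at h1
      rw [← div_lt_iff₀ c0] at h2
      have f1 : l j ≤ ⌊x j / 2 ^ k j⌋ := Int.le_floor.2 h1
      have f2 : ⌊x j / 2 ^ k j⌋ < l j + e := Int.floor_lt.2 (by push_cast; exact h2)
      refine ⟨⟨(⌊x j / 2 ^ k j⌋ - l j).toNat, by omega⟩, ?_⟩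
      have f3 : l j + ((⌊x j / 2 ^ k j⌋ - l j).toNat : ℤ) = ⌊x j / 2 ^ k j⌋ := by omega
      simp only [f3]
      rw [← le_div_iff₀ c0, ← div_lt_iff₀ c0]
      exact ⟨Int.floor_le _, by simp⟩
    choose ε hε using hf
    exact ⟨ε, hε⟩
  · rintro ⟨ε, h⟩ j
    obtain ⟨h1, h2⟩ := h j
    have c0 : (0 : ℝ) < 2 ^ k j := by positivity
    push_cast at h1 h2
    have e1 : (0 : ℝ) ≤ (ε j : ℕ) := by positivity
    have e2 : ((ε j : ℕ) : ℝ) + 1 ≤ e := by exact_mod_cast (ε j).2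
    exact ⟨le_trans (mul_le_mul_of_nonneg_right (by linarith) c0.le) h1,
      h2.trans_le (mul_le_mul_of_nonneg_right (by linarith) c0.le)⟩

/-- Choose `2 ^ k j` between the side length and its double. The dyadic interval of that length
containing `a j`, with its right neighbour, covers the side and is at most four times as long. -/
theorem exists_subset_dyadicBox_two {R : Set (Fin n → ℝ)} (hR : R ∈ rectangles n) :
    ∃ k l, R ⊆ dyadicBox 2 k l ∧ volume (dyadicBox 2 k l) ≤ 4 ^ n * volume R := by
  obtain ⟨a, b, h, rfl⟩ := hR
  have hk : ∀ j, ∃ k : ℤ, (2 : ℝ) ^ k ≤ 2 * (b j - a j) ∧ b j - a j ≤ 2 ^ k := by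
    intro j
    obtain ⟨k, hk⟩ := exists_mem_Ioc_zpow (sub_pos.2 (h j)) (one_lt_two (α := ℝ))
    refine ⟨k + 1, ?_, hk.2⟩
    rw [two_zpow_add_one]
    linarith [hk.1]
  choose k hk using hk
  refine ⟨k, fun j => ⌊a j / 2 ^ k j⌋, fun x hx => mem_dyadicBox.2 fun j => ?_, ?_⟩
  · have hx := hx j (Set.mem_univ j)
    have c0 : (0 : ℝ) < 2 ^ k j := by positivity
    have f1 := Int.floor_le (a j / 2 ^ k j)
    have f2 := Int.lt_floor_add_one (a j / 2 ^ k j)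
    rw [le_div_iff₀ c0] at f1
    rw [div_lt_iff₀ c0] at f2
    refine ⟨f1.trans hx.1, ?_⟩
    have := hx.2
    have := (hk j).2
    push_cast
    nlinarith
  · rw [volume_dyadicBox, Real.volume_pi_Ico]
    calc _ ≤ ∏ j, (4 * ENNReal.ofReal (b j - a j)) := by
          refine Finset.prod_le_prod' fun j _ => ?_
          rw [← ENNReal.ofReal_ofNat 4, ← ENNReal.ofReal_mul (by norm_num)]
          refine ENNReal.ofReal_le_ofReal ?_
          have := (hk j).1
          push_cast
          linarith
      _ = _ := by simp [Finset.prod_mul_distrib]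

/-! ### Hölder inequalities and contraction for normalized integrals -/

section Auxiliary

theorem prod_rpow_eq_rpow_sum {ι : Type*} {t : Finset ι} {x : ℝ≥0∞} (h0 : x ≠ 0) (h : x ≠ ∞)
    (a : ι → ℝ) : ∏ i ∈ t, x ^ a i = x ^ ∑ i ∈ t, a i := by
  classical
  induction t using Finset.induction_on with
  | empty => simp
  | insert i t hi ih =>
    rw [Finset.prod_insert hi, Finset.sum_insert hi, ih, ENNReal.rpow_add _ _ h0 h]

theorem ae_ne_zero_of_lintegral_rpow_neg_ne_top {X : Type*} [MeasurableSpace X] {μ : Measure X}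
    {w : X → ℝ≥0} (hw : AEMeasurable w μ) {r : ℝ} (hr : 0 < r)
    (h : ∫⁻ x, (w x : ℝ≥0∞) ^ (-r) ∂μ ≠ ∞) : ∀ᵐ x ∂μ, w x ≠ 0 := by
  filter_upwards [ae_lt_top' (hw.coe_nnreal_ennreal.pow_const _) h] with x hx h0
  rw [h0, ENNReal.coe_zero, ENNReal.zero_rpow_of_neg (by linarith)] at hx
  exact lt_irrefl _ hx

/-- Hölder's inequality against the dual weight. -/
theorem rpow_mul_lintegral_enorm_rpow_le {X : Type*} [MeasurableSpace X] {μ : Measure X}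
    {p p' : ℝ} (hp : p.HolderConjugate p') {w : X → ℝ≥0} (hw : AEMeasurable w μ) {f : X → ℝ}
    (hf : AEStronglyMeasurable f μ) (h0 : ∫⁻ x, (w x : ℝ≥0∞) ^ (-p') ∂μ ≠ 0)
    (h : ∫⁻ x, (w x : ℝ≥0∞) ^ (-p') ∂μ ≠ ∞) :
    ((∫⁻ x, (w x : ℝ≥0∞) ^ (-p') ∂μ) ^ (-(1 / p')) * ∫⁻ x, ‖f x‖ₑ ∂μ) ^ p ≤
      ∫⁻ x, (w x : ℝ≥0∞) ^ p * ‖f x‖ₑ ^ p ∂μ := by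
  have hwE := hw.coe_nnreal_ennreal
  have main := ENNReal.lintegral_mul_le_Lp_mul_Lq μ hp (f := fun x => (w x : ℝ≥0∞) * ‖f x‖ₑ)
    (g := fun x => (w x : ℝ≥0∞)⁻¹) (hwE.mul hf.enorm) hwE.inv
  have e1 : ∫⁻ x, ‖f x‖ₑ ∂μ =
      ∫⁻ x, ((fun x => (w x : ℝ≥0∞) * ‖f x‖ₑ) * (fun x => (w x : ℝ≥0∞)⁻¹)) x ∂μ := by
    refine lintegral_congr_ae ?_
    filter_upwards [ae_ne_zero_of_lintegral_rpow_neg_ne_top hw hp.symm.pos h] with x hx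
    have hx' : (w x : ℝ≥0∞) ≠ 0 := by simpa using hx
    simp only [Pi.mul_apply]
    rw [mul_comm, ← mul_assoc, ENNReal.inv_mul_cancel hx' ENNReal.coe_ne_top, one_mul]
  rw [← e1] at main
  simp only [ENNReal.mul_rpow_of_nonneg _ _ hp.nonneg, ENNReal.inv_rpow,
    ← ENNReal.rpow_neg] at main
  set S := ∫⁻ x, (w x : ℝ≥0∞) ^ (-p') ∂μ
  rw [← ENNReal.le_rpow_inv_iff hp.pos, ENNReal.rpow_neg, ENNReal.inv_mul_le_iff, ← one_div,
    mul_comm]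
  · exact main
  · have := hp.symm.pos
    simp [h0, h]
  · have := hp.symm.pos
    simp [h0, h]

/-- Two-term Hölder, after writing each `F` as `(S ^ (-(1 / p')) * F) * S ^ (1 / p')`. -/
theorem rpow_neg_mul_add_rpow_le {p p' : ℝ} (hp : p.HolderConjugate p') {S₁ S₂ : ℝ≥0∞}
    (h1 : S₁ ≠ 0) (h1' : S₁ ≠ ∞) (h2 : S₂ ≠ 0) (h2' : S₂ ≠ ∞) (F₁ F₂ : ℝ≥0∞) :
    ((S₁ + S₂) ^ (-(1 / p')) * (F₁ + F₂)) ^ p ≤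
      (S₁ ^ (-(1 / p')) * F₁) ^ p + (S₂ ^ (-(1 / p')) * F₂) ^ p := by
  have hp' := hp.symm.pos
  have b0 : 0 < 1 / p' := by positivity
  have main := ENNReal.inner_le_Lp_mul_Lq Finset.univ
    ![S₁ ^ (-(1 / p')) * F₁, S₂ ^ (-(1 / p')) * F₂] ![S₁ ^ (1 / p'), S₂ ^ (1 / p')] hp
  have cancel : ∀ S F : ℝ≥0∞, S ≠ 0 → S ≠ ∞ → S ^ (-(1 / p')) * F * S ^ (1 / p') = F := by
    intro S F h h'
    rw [mul_right_comm, ← ENNReal.rpow_add _ _ h h', neg_add_cancel, ENNReal.rpow_zero, one_mul]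
  simp only [Fin.sum_univ_two, Matrix.cons_val_zero, Matrix.cons_val_one] at main
  rw [cancel _ _ h1 h1', cancel _ _ h2 h2', ← ENNReal.rpow_mul, ← ENNReal.rpow_mul,
    one_div_mul_cancel hp'.ne', ENNReal.rpow_one, ENNReal.rpow_one] at main
  rw [← ENNReal.le_rpow_inv_iff hp.pos, ENNReal.rpow_neg, ENNReal.inv_mul_le_iff, ← one_div p,
    mul_comm]
  · exact main
  · simp [h1, h1', h2, h2']
  · simp [h1, h1', h2, h2']

/-- Under doubling each part keeps a definite share of the total, so the other is at most `β < 1`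
times the total. The negative power turns this into the contraction factor `β ^ b`. -/
theorem exists_rpow_neg_mul_add_le (L : ℝ≥0) {b : ℝ} (hb : 0 < b) :
    ∃ γ : ℝ≥0, γ < 1 ∧ ∀ S₁ S₂ F₁ F₂ : ℝ≥0∞, S₁ ≠ 0 → S₁ ≠ ∞ → S₂ ≠ 0 → S₂ ≠ ∞ →
      S₁ + S₂ ≤ L * S₁ → S₁ + S₂ ≤ L * S₂ →
      (S₁ + S₂) ^ (-b) * (F₁ + F₂) ≤ γ * (S₁ ^ (-b) * F₁ + S₂ ^ (-b) * F₂) := by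
  -- Enlarging `L` to at least `2` puts `β = 1 - M⁻¹` strictly between `0` and `1`.
  set M : ℝ≥0 := L + 2 with hM
  have M2 : 2 ≤ M := le_add_self
  have M0 : 0 < M := lt_of_lt_of_le two_pos M2
  have Minv : M⁻¹ < 1 := inv_lt_one_of_one_lt₀ (lt_of_lt_of_le one_lt_two M2)
  set β : ℝ≥0 := 1 - M⁻¹ with hβ
  have β1 : β < 1 := tsub_lt_self one_pos (inv_pos.2 M0)
  have β0 : 0 < β := tsub_pos_of_lt Minv
  refine ⟨β ^ b, NNReal.rpow_lt_one β1 hb, fun S₁ S₂ F₁ F₂ h1 h1' h2 h2' hL1 hL2 => ?_⟩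
  have key : ∀ A B : ℝ≥0∞, A ≠ 0 → A ≠ ∞ → B ≠ ∞ → A + B ≤ L * B →
      (A + B) ^ (-b) ≤ ((β ^ b : ℝ≥0) : ℝ≥0∞) * A ^ (-b) := by
    intro A B hA hA' hB' h
    have hle : A ≤ β * (A + B) := by
      lift A to ℝ≥0 using hA'
      lift B to ℝ≥0 using hB'
      norm_cast at h ⊢
      have hMB : A + B ≤ M * B := h.trans (by gcongr; exact le_self_add)
      have : M⁻¹ * (A + B) ≤ B := by
        calc _ ≤ M⁻¹ * (M * B) := by gcongr
          _ = B := inv_mul_cancel_left₀ M0.ne' B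
      rw [hβ, tsub_mul, one_mul]
      refine le_tsub_of_add_le_right ?_
      gcongr
    rw [ENNReal.coe_rpow_of_nonneg _ hb.le, ENNReal.rpow_neg, ENNReal.rpow_neg,
      ENNReal.inv_le_iff_inv_le, ENNReal.mul_inv, inv_inv]
    · rw [ENNReal.inv_mul_le_iff, ← ENNReal.mul_rpow_of_nonneg _ _ hb.le]
      · exact ENNReal.rpow_le_rpow hle hb.le
      · simp [β0.ne', hb]
      · simp [β0.ne']
    · left
      simp [β0.ne', hb]
    · left
      simp [β0.ne']
  rw [mul_add, mul_add, ← mul_assoc, ← mul_assoc]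
  refine add_le_add (mul_le_mul_left ?_ _) (mul_le_mul_left ?_ _)
  · exact key S₁ S₂ h1 h1' h2' hL2
  · rw [add_comm]
    refine key S₂ S₁ h2 h2' h1' ?_
    rwa [add_comm]

end Auxiliary

/-! ### The weight condition in terms of masses -/

/-- The mass `∫_R ν_ω^q`. -/
noncomputable def prodMass (q : ℝ) (ω : Fin m → (Fin n → ℝ) → ℝ≥0) (R : Set (Fin n → ℝ)) :
    ℝ≥0∞ :=
  ∫⁻ x in R, (prodWeight ω x : ℝ≥0∞) ^ q

/-- The mass `∫_R w^{-r}` of the dual weight. -/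
noncomputable def dualMass (r : ℝ) (w : (Fin n → ℝ) → ℝ≥0) (R : Set (Fin n → ℝ)) : ℝ≥0∞ :=
  ∫⁻ x in R, (w x : ℝ≥0∞) ^ (-r)

/-- The condition `A_{(p⃗,q)}` with explicit constant `K`, without averages. -/
def MultiWeightBound (𝓕 : Set (Set (Fin n → ℝ))) (r : Fin m → ℝ) (q : ℝ)
    (ω : Fin m → (Fin n → ℝ) → ℝ≥0) (K : ℝ≥0) : Prop :=
  ∀ R ∈ 𝓕, prodMass q ω R ^ (1 / q) * ∏ i, dualMass (r i) (ω i) R ^ (1 / r i) ≤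
    K * volume R ^ (1 / q + ∑ i, 1 / r i)

theorem multiWeightClass_iff {𝓕 : Set (Set (Fin n → ℝ))} (h𝓕 : 𝓕 ⊆ rectangles n)
    {p : Fin m → ℝ} (hp : ∀ i, 1 < p i) {q : ℝ} (hq : 0 < q) (ω : Fin m → (Fin n → ℝ) → ℝ≥0) :
    MultiWeightClass 𝓕 p q ω ↔
      ∃ K : ℝ≥0, MultiWeightBound 𝓕 (fun i => (p i).conjExponent) q ω K := by
  have r0 : ∀ i, 0 < (p i).conjExponent := fun i =>
    (Real.HolderConjugate.conjExponent (hp i)).symm.pos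
  have eq : ∀ R ∈ 𝓕, (⨍⁻ x in R, (prodWeight ω x : ℝ≥0∞) ^ q ∂volume) ^ (1 / q) *
      ∏ i, (⨍⁻ x in R, (ω i x : ℝ≥0∞) ^ (-(p i).conjExponent) ∂volume) ^
      (1 / (p i).conjExponent) = (prodMass q ω R ^ (1 / q) *
        ∏ i, dualMass ((p i).conjExponent) (ω i) R ^ (1 / (p i).conjExponent)) /
        volume R ^ (1 / q + ∑ i, 1 / (p i).conjExponent) := by
    intro R hR
    have v0 := volume_ne_zero_of_mem_rectangles (h𝓕 hR)
    have v1 := volume_ne_top_of_mem_rectangles (h𝓕 hR)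
    simp only [setLAverage_eq, div_eq_mul_inv]
    rw [ENNReal.mul_rpow_of_nonneg _ _ (by positivity)]
    have : ∀ i, ((∫⁻ x in R, (ω i x : ℝ≥0∞) ^ (-(p i).conjExponent)) * (volume R)⁻¹) ^
        (1 * (p i).conjExponent⁻¹) =
        dualMass ((p i).conjExponent) (ω i) R ^ (1 * (p i).conjExponent⁻¹) *
          volume R ^ (-(1 * (p i).conjExponent⁻¹)) := by
      intro i
      have := r0 i
      rw [ENNReal.mul_rpow_of_nonneg _ _ (by positivity), ENNReal.inv_rpow, ENNReal.rpow_neg]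
      rfl
    simp_rw [this]
    rw [Finset.prod_mul_distrib, ENNReal.inv_rpow, ← ENNReal.rpow_neg, ← ENNReal.rpow_neg,
      neg_add, ENNReal.rpow_add _ _ v0 v1, ← Finset.sum_neg_distrib,
      ← prod_rpow_eq_rpow_sum v0 v1, prodMass]
    ring
  have div_le : ∀ R ∈ 𝓕, ∀ (x : ℝ≥0∞) (K : ℝ≥0∞) (θ : ℝ), x / volume R ^ θ ≤ K ↔
      x ≤ K * volume R ^ θ := by
    intro R hR x K θ
    have v0 := volume_ne_zero_of_mem_rectangles (h𝓕 hR)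
    have v1 := volume_ne_top_of_mem_rectangles (h𝓕 hR)
    rw [ENNReal.div_le_iff_le_mul]
    · left; simp [v0, v1]
    · left; simp [v0, v1]
  unfold MultiWeightClass MultiWeightBound
  constructor
  · intro h
    refine ⟨(⨆ R ∈ 𝓕, (⨍⁻ x in R, (prodWeight ω x : ℝ≥0∞) ^ q ∂volume) ^ (1 / q) *
      ∏ i, (⨍⁻ x in R, (ω i x : ℝ≥0∞) ^ (-(p i).conjExponent) ∂volume) ^
        (1 / (p i).conjExponent)).toNNReal, fun R hR => ?_⟩
    rw [← div_le R hR, ← eq R hR, ENNReal.coe_toNNReal h.ne]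
    exact le_iSup₂_of_le R hR le_rfl
  · rintro ⟨K, hK⟩
    refine lt_of_le_of_lt (iSup₂_le fun R hR => ?_) (ENNReal.coe_lt_top (r := K))
    rw [eq R hR, div_le R hR]
    exact hK R hR

section Masses

variable {r : Fin m → ℝ} {q : ℝ} {ω : Fin m → (Fin n → ℝ) → ℝ≥0}

theorem dualMass_mono {r : ℝ} {w : (Fin n → ℝ) → ℝ≥0} {E R : Set (Fin n → ℝ)} (h : E ⊆ R) :
    dualMass r w E ≤ dualMass r w R :=
  lintegral_mono_set h

theorem prodMass_mono {E R : Set (Fin n → ℝ)} (h : E ⊆ R) : prodMass q ω E ≤ prodMass q ω R :=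
  lintegral_mono_set h

theorem dualMass_ne_zero {r : ℝ} (hr : 0 < r) {w : (Fin n → ℝ) → ℝ≥0} (hw : AEMeasurable w volume)
    {R : Set (Fin n → ℝ)} (hR : volume R ≠ 0) : dualMass r w R ≠ 0 := by
  intro h
  rw [dualMass, lintegral_eq_zero_iff' (hw.coe_nnreal_ennreal.pow_const _).restrict] at h
  have : ∀ᵐ x ∂(volume.restrict R), False := by
    filter_upwards [h] with x hx
    rw [Pi.zero_apply, ENNReal.rpow_eq_zero_iff] at hx
    rcases hx with hx | hx
    · linarith [hx.2]
    · exact ENNReal.coe_ne_top hx.1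
  simp [hR] at this

theorem ae_weight_ne_zero {r : ℝ} (hr : 0 < r) {w : (Fin n → ℝ) → ℝ≥0}
    (hw : AEMeasurable w volume) {R : Set (Fin n → ℝ)} (hR : dualMass r w R ≠ ∞) :
    ∀ᵐ x ∂(volume.restrict R), w x ≠ 0 :=
  ae_ne_zero_of_lintegral_rpow_neg_ne_top hw.restrict hr hR

theorem aemeasurable_prodWeight (hω : ∀ i, AEMeasurable (ω i) volume) :
    AEMeasurable (prodWeight ω) volume :=
  Finset.aemeasurable_fun_prod _ fun i _ => hω i

theorem prodMass_ne_zero (hr : ∀ i, 0 < r i) (hω : ∀ i, AEMeasurable (ω i) volume)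
    {R : Set (Fin n → ℝ)} (hR : volume R ≠ 0) (h : ∀ i, dualMass (r i) (ω i) R ≠ ∞) :
    prodMass q ω R ≠ 0 := by
  intro h0
  rw [prodMass, lintegral_eq_zero_iff'
    ((aemeasurable_prodWeight hω).coe_nnreal_ennreal.pow_const _).restrict] at h0
  have : ∀ᵐ x ∂(volume.restrict R), False := by
    filter_upwards [h0, ae_all_iff.2 fun i => ae_weight_ne_zero (hr i) (hω i) (h i)] with x hx hx'
    rw [Pi.zero_apply, ENNReal.rpow_eq_zero_iff] at hx
    rcases hx with hx | hx
    · exact Finset.prod_ne_zero_iff.2 (fun i _ => hx' i) (ENNReal.coe_eq_zero.1 hx.1)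
    · exact ENNReal.coe_ne_top hx.1
  simp [hR] at this

/-- Hölder's inequality for the weights `ν_ω` and `ωᵢ⁻¹`, whose product is one. -/
theorem volume_rpow_le (hr : ∀ i, 0 < r i) (hq : 0 < q) (hω : ∀ i, AEMeasurable (ω i) volume)
    {R : Set (Fin n → ℝ)} (h : ∀ i, dualMass (r i) (ω i) R ≠ ∞) :
    volume R ^ (1 / q + ∑ i, 1 / r i) ≤
      prodMass q ω R ^ (1 / q) * ∏ i, dualMass (r i) (ω i) R ^ (1 / r i) := by
  set θ := 1 / q + ∑ i, 1 / r i with hθ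
  have θ0 : 0 < θ := by
    have : 0 ≤ ∑ i, 1 / r i := Finset.sum_nonneg fun i _ => by have := hr i; positivity
    positivity
  -- Dividing the exponents by `θ` makes them sum to one; with these powers the integrand is `1`
  -- wherever no `ωᵢ` vanishes.
  have main := ENNReal.lintegral_mul_prod_norm_pow_le (μ := volume.restrict R) Finset.univ
    (g := fun x => (prodWeight ω x : ℝ≥0∞) ^ q) (f := fun i x => (ω i x : ℝ≥0∞) ^ (-(r i)))
    ((aemeasurable_prodWeight hω).coe_nnreal_ennreal.pow_const _).restrict
    (fun i _ => ((hω i).coe_nnreal_ennreal.pow_const _).restrict) (1 / q / θ)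
    (p := fun i => 1 / r i / θ)
    (by rw [← Finset.sum_div, ← add_div, ← hθ, div_self θ0.ne']) (by positivity)
    (fun i _ => by have := hr i; positivity)
  have e1 : volume R = ∫⁻ x in R, ((prodWeight ω x : ℝ≥0∞) ^ q) ^ (1 / q / θ) *
      ∏ i, ((ω i x : ℝ≥0∞) ^ (-(r i))) ^ (1 / r i / θ) := by
    rw [← setLIntegral_one]
    refine lintegral_congr_ae ?_
    filter_upwards [ae_all_iff.2 fun i => ae_weight_ne_zero (hr i) (hω i) (h i)] with x hx
    have e2 : ∀ i, ((ω i x : ℝ≥0∞) ^ (-(r i))) ^ (1 / r i / θ) =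
        ((ω i x : ℝ≥0∞) ^ (1 / θ))⁻¹ := by
      intro i
      rw [← ENNReal.rpow_mul, ← ENNReal.rpow_neg]
      congr 1
      have := (hr i).ne'
      field_simp
    have e3 : ((prodWeight ω x : ℝ≥0∞) ^ q) ^ (1 / q / θ) = ∏ i, (ω i x : ℝ≥0∞) ^ (1 / θ) := by
      rw [← ENNReal.rpow_mul, ENNReal.prod_rpow_of_nonneg (by positivity), prodWeight,
        ENNReal.ofNNReal_finsetProd]
      congr 1
      field_simp
    simp_rw [e2]
    rw [e3, ← Finset.prod_mul_distrib, Finset.prod_eq_one]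
    intro i _
    refine ENNReal.mul_inv_cancel ?_ ?_
    · simp [hx i]
    · simp [θ0.le]
  rw [← e1] at main
  refine (ENNReal.rpow_le_rpow main θ0.le).trans_eq ?_
  rw [ENNReal.mul_rpow_of_nonneg _ _ θ0.le, ← ENNReal.rpow_mul, div_mul_cancel₀ _ θ0.ne',
    ← ENNReal.prod_rpow_of_nonneg θ0.le]
  congr 1
  refine Finset.prod_congr rfl fun i _ => ?_
  rw [← ENNReal.rpow_mul, div_mul_cancel₀ _ θ0.ne', dualMass]

variable {𝓕 : Set (Set (Fin n → ℝ))} {K : ℝ≥0}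

/-- The dual masses are never zero, so a nonzero `ν_ω` mass leaves no factor that could hide an
infinite one by `0 * ∞ = 0`; the product itself is finite. -/
theorem MultiWeightBound.ne_top (hK : MultiWeightBound 𝓕 r q ω K) (h𝓕 : 𝓕 ⊆ rectangles n)
    (hr : ∀ i, 0 < r i) (hq : 0 < q) (hω : ∀ i, AEMeasurable (ω i) volume)
    {R : Set (Fin n → ℝ)} (hR : R ∈ 𝓕) (hN : prodMass q ω R ≠ 0) :
    prodMass q ω R ≠ ∞ ∧ ∀ i, dualMass (r i) (ω i) R ≠ ∞ := by
  have v0 := volume_ne_zero_of_mem_rectangles (h𝓕 hR)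
  have v1 := volume_ne_top_of_mem_rectangles (h𝓕 hR)
  have q0 : 0 < 1 / q := by positivity
  have r0 : ∀ i, 0 < 1 / r i := fun i => by have := hr i; positivity
  have fin : prodMass q ω R ^ (1 / q) * ∏ i, dualMass (r i) (ω i) R ^ (1 / r i) ≠ ∞ := by
    refine ((hK R hR).trans_lt (ENNReal.mul_lt_top ENNReal.coe_lt_top ?_)).ne
    exact (ENNReal.rpow_ne_top_of_ne_zero v0 v1).lt_top
  have a0 : prodMass q ω R ^ (1 / q) ≠ 0 := by simp [hN, hq.le]
  have b0 : ∀ i, dualMass (r i) (ω i) R ^ (1 / r i) ≠ 0 := fun i => by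
    simp [dualMass_ne_zero (hr i) (hω i) v0, (hr i).le]
  refine ⟨fun h => fin ?_, fun i h => fin ?_⟩
  · rw [h, ENNReal.top_rpow_of_pos q0, ENNReal.top_mul (Finset.prod_ne_zero_iff.2 fun i _ => b0 i)]
  · rw [← Finset.mul_prod_erase _ _ (Finset.mem_univ i), h, ENNReal.top_rpow_of_pos (r0 i),
      ENNReal.top_mul (Finset.prod_ne_zero_iff.2 fun i _ => b0 i), ENNReal.mul_top a0]

/-- The dual weights are doubling. -/
theorem MultiWeightBound.dualMass_le (hK : MultiWeightBound 𝓕 r q ω K) (h𝓕 : 𝓕 ⊆ rectangles n)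
    (hr : ∀ i, 0 < r i) (hq : 0 < q) (hω : ∀ i, AEMeasurable (ω i) volume)
    {E R : Set (Fin n → ℝ)} (hR : R ∈ 𝓕) (hER : E ⊆ R) (hN : prodMass q ω R ≠ 0)
    (hv : volume R = 2 * volume E) (i : Fin m) :
    dualMass (r i) (ω i) R ≤
      (((K * 2 ^ (1 / q + ∑ i, 1 / r i)) ^ r i : ℝ≥0) : ℝ≥0∞) * dualMass (r i) (ω i) E := by
  have v0 := volume_ne_zero_of_mem_rectangles (h𝓕 hR)
  have v1 := volume_ne_top_of_mem_rectangles (h𝓕 hR)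
  set θ := 1 / q + ∑ i, 1 / r i with hθ
  have θ0 : 0 < θ := by
    have : 0 ≤ ∑ i, 1 / r i := Finset.sum_nonneg fun i _ => by have := hr i; positivity
    positivity
  obtain ⟨Nt, St⟩ := hK.ne_top h𝓕 hr hq hω hR hN
  have hi := hr i
  have SE : ∀ j, dualMass (r j) (ω j) E ≠ ∞ := fun j =>
    ne_top_of_le_ne_top (St j) (dualMass_mono hER)
  -- `X` collects the factors other than the `i`-th, all over `R`. The weight condition on `R` and
  -- the reverse Hölder bound on `E` share this factor, which then cancels.
  set X := prodMass q ω R ^ (1 / q) *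
    ∏ j ∈ Finset.univ.erase i, dualMass (r j) (ω j) R ^ (1 / r j) with hX
  have e1 : X * dualMass (r i) (ω i) R ^ (1 / r i) ≤ K * volume R ^ θ := by
    refine le_trans (le_of_eq ?_) (hK R hR)
    rw [← Finset.mul_prod_erase _ _ (Finset.mem_univ i), hX]
    ring
  have e2 : volume E ^ θ ≤ X * dualMass (r i) (ω i) E ^ (1 / r i) := by
    refine (volume_rpow_le hr hq hω SE).trans ?_
    rw [← Finset.mul_prod_erase _ _ (Finset.mem_univ i), hX,
      mul_comm (dualMass (r i) (ω i) E ^ (1 / r i)), ← mul_assoc]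
    refine mul_le_mul_left (mul_le_mul' (ENNReal.rpow_le_rpow (prodMass_mono hER) (by positivity))
      (Finset.prod_le_prod' fun j _ => ENNReal.rpow_le_rpow (dualMass_mono hER) ?_)) _
    have := hr j
    positivity
  have X0 : X ≠ 0 := by
    refine mul_ne_zero (by simp [hN, hq.le]) (Finset.prod_ne_zero_iff.2 fun j _ => ?_)
    simp [dualMass_ne_zero (hr j) (hω j) v0, (hr j).le]
  have X1 : X ≠ ∞ := by
    refine ENNReal.mul_ne_top (by simp [Nt, hq.le]) (ENNReal.prod_ne_top fun j _ => ?_)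
    exact ENNReal.rpow_ne_top_of_nonneg (by have := hr j; positivity) (St j)
  have e3 : X * dualMass (r i) (ω i) R ^ (1 / r i) ≤
      X * (K * 2 ^ θ * dualMass (r i) (ω i) E ^ (1 / r i)) := by
    calc _ ≤ K * volume R ^ θ := e1
      _ = K * 2 ^ θ * volume E ^ θ := by
        rw [hv, ENNReal.mul_rpow_of_nonneg _ _ θ0.le, mul_assoc]
      _ ≤ K * 2 ^ θ * (X * dualMass (r i) (ω i) E ^ (1 / r i)) := by gcongr
      _ = _ := by ring
  have e4 := (ENNReal.mul_le_mul_iff_right X0 X1).1 e3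
  have e5 := ENNReal.rpow_le_rpow e4 hi.le
  rw [ENNReal.mul_rpow_of_nonneg _ _ hi.le, ← ENNReal.rpow_mul, ← ENNReal.rpow_mul,
    one_div_mul_cancel hi.ne', ENNReal.rpow_one, ENNReal.rpow_one] at e5
  refine e5.trans (le_of_eq ?_)
  rw [ENNReal.coe_rpow_of_nonneg _ hi.le]
  push_cast [ENNReal.coe_rpow_of_nonneg _ θ0.le]
  rfl

end Masses

/-! ### The weight condition implies the strong type inequality -/

section Sufficiency

/-- The integral of `|f|` over `R`, normalized by the dual mass of `ωᵢ`; it is set to zero if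
`ν_ω` vanishes on `R`. -/
noncomputable def normalizedIntegral (r : Fin m → ℝ) (q : ℝ) (ω : Fin m → (Fin n → ℝ) → ℝ≥0)
    (i : Fin m) (f : (Fin n → ℝ) → ℝ) (R : Set (Fin n → ℝ)) : ℝ≥0∞ :=
  open scoped Classical in
  if prodMass q ω R = 0 then 0 else dualMass (r i) (ω i) R ^ (-(1 / r i)) * ∫⁻ y in R, ‖f y‖ₑ

variable {p r : Fin m → ℝ} {q s : ℝ} {ω : Fin m → (Fin n → ℝ) → ℝ≥0} {K : ℝ≥0}
  {𝓕 : Set (Set (Fin n → ℝ))}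

/-- Finite dual masses on `R` force every `ωᵢ` to be positive a.e. there, so `ν_ω` cannot vanish on
a part of positive measure. -/
theorem MultiWeightBound.prodMass_ne_zero_of_subset (hK : MultiWeightBound 𝓕 r q ω K)
    (h𝓕 : 𝓕 ⊆ rectangles n) (hr : ∀ i, 0 < r i) (hq : 0 < q)
    (hω : ∀ i, AEMeasurable (ω i) volume) {R E : Set (Fin n → ℝ)} (hR : R ∈ 𝓕) (hE : volume E ≠ 0)
    (hER : E ⊆ R) (hN : prodMass q ω R ≠ 0) : prodMass q ω E ≠ 0 :=
  prodMass_ne_zero hr hω hE fun i =>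
    ne_top_of_le_ne_top ((hK.ne_top h𝓕 hr hq hω hR hN).2 i) (dualMass_mono hER)

theorem MultiWeightBound.normalizedIntegral_rpow_le (hK : MultiWeightBound 𝓕 r q ω K)
    (h𝓕 : 𝓕 ⊆ rectangles n) (hp : ∀ i, (p i).HolderConjugate (r i)) (hq : 0 < q)
    (hω : ∀ i, AEMeasurable (ω i) volume) {R : Set (Fin n → ℝ)} (hR : R ∈ 𝓕) (i : Fin m)
    {f : (Fin n → ℝ) → ℝ} (hf : AEStronglyMeasurable f volume) :
    normalizedIntegral r q ω i f R ^ p i ≤ ∫⁻ x in R, (ω i x : ℝ≥0∞) ^ p i * ‖f x‖ₑ ^ p i := by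
  have hr : ∀ i, 0 < r i := fun i => (hp i).symm.pos
  rw [normalizedIntegral]
  split_ifs with h
  · rw [ENNReal.zero_rpow_of_pos (hp i).pos]
    exact zero_le
  · exact rpow_mul_lintegral_enorm_rpow_le (hp i) (hω i).restrict hf.restrict
      (dualMass_ne_zero (hr i) (hω i) (volume_ne_zero_of_mem_rectangles (h𝓕 hR)))
      ((hK.ne_top h𝓕 hr hq hω hR h).2 i)

theorem MultiWeightBound.exists_tsum_dyadicBox_one_le (hK : MultiWeightBound 𝓕 r q ω K)
    (h𝓕 : 𝓕 ⊆ rectangles n) (hd : dyadicRectangles n ⊆ 𝓕)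
    (hp : ∀ i, (p i).HolderConjugate (r i)) (hq : 0 < q)
    (hω : ∀ i, AEMeasurable (ω i) volume) (hs : 1 < s) (i : Fin m) :
    ∃ C : ℝ≥0, ∀ f : (Fin n → ℝ) → ℝ, AEStronglyMeasurable f volume →
      ∑' k, ∑' l, normalizedIntegral r q ω i f (dyadicBox 1 k l) ^ (p i * s) ≤
        C * (∫⁻ x, (ω i x : ℝ≥0∞) ^ p i * ‖f x‖ₑ ^ p i) ^ s := by
  have hr : ∀ i, 0 < r i := fun i => (hp i).symm.pos
  have hri := hr i
  have mem : ∀ k l, dyadicBox 1 k l ∈ 𝓕 := fun k l => hd (dyadicBox_mem_dyadicRectangles k l)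
  have v0 : ∀ k l : Fin n → ℤ, volume (dyadicBox 1 k l) ≠ 0 := fun k l =>
    volume_ne_zero_of_mem_rectangles (h𝓕 (mem k l))
  -- The doubling constant of `MultiWeightBound.dualMass_le` determines `γ`.
  obtain ⟨γ, hγ, hγ'⟩ := exists_rpow_neg_mul_add_le
    ((K * 2 ^ (1 / q + ∑ i, 1 / r i)) ^ r i) (b := 1 / r i) (by positivity)
  obtain ⟨C, hC⟩ := exists_tsum_all_dyadic_rectangle_le hγ (hp i).pos hs n
  refine ⟨C, fun f hf => hC (fun k l => normalizedIntegral r q ω i f (dyadicBox 1 k l)) _ ?_ ?_ ?_⟩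
  rotate_right
  · intro k
    calc _ ≤ ∑' l, ∫⁻ x in dyadicBox 1 k l, (ω i x : ℝ≥0∞) ^ p i * ‖f x‖ₑ ^ p i :=
          ENNReal.tsum_le_tsum fun l => hK.normalizedIntegral_rpow_le h𝓕 hp hq hω (mem k l) i hf
      _ = ∫⁻ x in ⋃ l, dyadicBox 1 k l, (ω i x : ℝ≥0∞) ^ p i * ‖f x‖ₑ ^ p i :=
          (lintegral_iUnion (fun l => measurableSet_dyadicBox 1 k l)
            (fun l l' h => disjoint_dyadicBox k h) _).symm
      _ ≤ _ := setLIntegral_le_lintegral _ _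
  all_goals
    intro j k l
    set R := dyadicBox 1 (Function.update k j (k j + 1)) l with hR
    set R₁ := dyadicBox 1 k (Function.update l j (2 * l j)) with hR₁
    set R₂ := dyadicBox 1 k (Function.update l j (2 * l j + 1)) with hR₂
    have hun : R = R₁ ∪ R₂ := dyadicBox_eq_union j k l
    have hdis : Disjoint R₁ R₂ := disjoint_dyadicBox k fun h => by
      have := congrFun h j
      simp at this
    have hm : MeasurableSet R₂ := measurableSet_dyadicBox 1 _ _
    have hs₁ : R₁ ⊆ R := hun ▸ Set.subset_union_left
    have hs₂ : R₂ ⊆ R := hun ▸ Set.subset_union_right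
    by_cases hN : prodMass q ω R = 0
    · simp [normalizedIntegral, hN, (hp i).pos]
    have hN₁ : prodMass q ω R₁ ≠ 0 := hK.prodMass_ne_zero_of_subset h𝓕 hr hq hω (mem _ _) (v0 _ _) hs₁ hN
    have hN₂ : prodMass q ω R₂ ≠ 0 := hK.prodMass_ne_zero_of_subset h𝓕 hr hq hω (mem _ _) (v0 _ _) hs₂ hN
    have hS : dualMass (r i) (ω i) R = dualMass (r i) (ω i) R₁ + dualMass (r i) (ω i) R₂ := by
      rw [hun]
      exact lintegral_union hm hdis
    have hF : ∫⁻ y in R, ‖f y‖ₑ = (∫⁻ y in R₁, ‖f y‖ₑ) + ∫⁻ y in R₂, ‖f y‖ₑ := by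
      rw [hun]
      exact lintegral_union hm hdis
    have a1 := dualMass_ne_zero hri (hω i) (v0 k (Function.update l j (2 * l j)))
    have a2 := dualMass_ne_zero hri (hω i) (v0 k (Function.update l j (2 * l j + 1)))
    have b1 := (hK.ne_top h𝓕 hr hq hω (mem _ _) hN₁).2 i
    have b2 := (hK.ne_top h𝓕 hr hq hω (mem _ _) hN₂).2 i
    simp only [normalizedIntegral, hN, hN₁, hN₂, if_false]
    rw [hF]
  · have c1 := hK.dualMass_le h𝓕 hr hq hω (mem _ _) hs₁ hN (volume_dyadicBox_update j k l _) i
    have c2 := hK.dualMass_le h𝓕 hr hq hω (mem _ _) hs₂ hN (volume_dyadicBox_update j k l _) i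
    rw [hS] at c1 c2 ⊢
    exact hγ' _ _ _ _ a1 b1 a2 b2 c1 c2
  · rw [hS]
    exact rpow_neg_mul_add_rpow_le (hp i) a1 b1 a2 b2 _ _

/-- The integral is subadditive over the pieces, and each piece has a smaller dual mass, hence a
larger normalizing factor. -/
theorem MultiWeightBound.normalizedIntegral_dyadicBox_le (hK : MultiWeightBound 𝓕 r q ω K)
    (h𝓕 : 𝓕 ⊆ rectangles n) (hr : ∀ i, 0 < r i) (hq : 0 < q)
    (hω : ∀ i, AEMeasurable (ω i) volume) {e : ℕ} {k l : Fin n → ℤ} (he : dyadicBox e k l ∈ 𝓕)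
    (i : Fin m) (f : (Fin n → ℝ) → ℝ) :
    normalizedIntegral r q ω i f (dyadicBox e k l) ≤ ∑ ε : Fin n → Fin e,
      normalizedIntegral r q ω i f (dyadicBox 1 k (fun j => l j + (ε j : ℤ))) := by
  by_cases hN : prodMass q ω (dyadicBox e k l) = 0
  · simp [normalizedIntegral, hN]
  have hsub : ∀ ε : Fin n → Fin e,
      dyadicBox 1 k (fun j => l j + (ε j : ℤ)) ⊆ dyadicBox e k l := by
    rw [dyadicBox_eq_iUnion e k l]
    exact fun ε => Set.subset_iUnion (fun ε : Fin n → Fin e =>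
      dyadicBox 1 k (fun j => l j + (ε j : ℤ))) ε
  have hN' : ∀ ε : Fin n → Fin e, prodMass q ω (dyadicBox 1 k (fun j => l j + (ε j : ℤ))) ≠ 0 :=
    fun ε => hK.prodMass_ne_zero_of_subset h𝓕 hr hq hω he
      (volume_ne_zero_of_mem_rectangles (dyadicBox_mem_rectangles one_pos _ _)) (hsub ε) hN
  simp only [normalizedIntegral, hN, hN', if_false]
  have hF : ∫⁻ y in dyadicBox e k l, ‖f y‖ₑ ≤
      ∑ ε : Fin n → Fin e, ∫⁻ y in dyadicBox 1 k (fun j => l j + (ε j : ℤ)), ‖f y‖ₑ := by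
    rw [dyadicBox_eq_iUnion e k l, ← tsum_fintype (L := .unconditional _)]
    exact lintegral_iUnion_le _ _
  refine (mul_le_mul_right hF _).trans ?_
  rw [Finset.mul_sum]
  refine Finset.sum_le_sum fun ε _ => mul_le_mul_left ?_ _
  have := hr i
  rw [ENNReal.rpow_neg, ENNReal.rpow_neg, ENNReal.inv_le_inv]
  exact ENNReal.rpow_le_rpow (dualMass_mono (hsub ε)) (by positivity)

theorem MultiWeightBound.exists_tsum_dyadicBox_le (hK : MultiWeightBound 𝓕 r q ω K)
    (h𝓕 : 𝓕 ⊆ rectangles n) (hd : dyadicRectangles n ⊆ 𝓕)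
    (hp : ∀ i, (p i).HolderConjugate (r i)) (hq : 0 < q)
    (hω : ∀ i, AEMeasurable (ω i) volume) (hs : 1 < s) {e : ℕ}
    (he : ∀ k l, dyadicBox e k l ∈ 𝓕) (i : Fin m) :
    ∃ C : ℝ≥0, ∀ f : (Fin n → ℝ) → ℝ, AEStronglyMeasurable f volume →
      ∑' k, ∑' l, normalizedIntegral r q ω i f (dyadicBox e k l) ^ (p i * s) ≤
        C * (∫⁻ x, (ω i x : ℝ≥0∞) ^ p i * ‖f x‖ₑ ^ p i) ^ s := by
  obtain ⟨C, hC⟩ := hK.exists_tsum_dyadicBox_one_le h𝓕 hd hp hq hω hs i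
  have hr : ∀ i, 0 < r i := fun i => (hp i).symm.pos
  have t1 : 1 ≤ p i * s := by nlinarith [(hp i).lt]
  have t0 : 0 < p i * s := by linarith
  refine ⟨(Fintype.card (Fin n → Fin e)) ^ (p i * s) * C, fun f hf => ?_⟩
  refine le_trans ?_ ((mul_le_mul_right (hC f hf)
    ((Fintype.card (Fin n → Fin e) : ℝ≥0∞) ^ (p i * s))).trans_eq ?_)
  swap
  · push_cast [ENNReal.coe_rpow_of_nonneg _ t0.le]
    rw [mul_assoc]
  set g : (Fin n → Fin e) → (Fin n → ℤ) × (Fin n → ℤ) → ℝ≥0∞ := fun ε y =>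
    normalizedIntegral r q ω i f (dyadicBox 1 y.1 (fun j => y.2 j + (ε j : ℤ))) with hg
  -- For fixed `ε` the pieces again run through all dyadic rectangles exactly once, so Minkowski
  -- adds `e ^ n` equal norms.
  have shift : ∀ ε, ∑' y, g ε y ^ (p i * s) =
      ∑' k, ∑' l, normalizedIntegral r q ω i f (dyadicBox 1 k l) ^ (p i * s) := by
    intro ε
    rw [ENNReal.tsum_prod']
    exact tsum_congr fun k => (Equiv.addRight (fun j => (ε j : ℤ))).tsum_eq
      fun l => normalizedIntegral r q ω i f (dyadicBox 1 k l) ^ (p i * s)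
  have mink := tsum_rpow_tsum_le t1 g
  simp_rw [shift, tsum_fintype] at mink
  rw [one_div, ENNReal.rpow_inv_le_iff t0] at mink
  rw [Finset.sum_const, nsmul_eq_mul, ENNReal.mul_rpow_of_nonneg _ _ t0.le,
    ENNReal.rpow_inv_rpow t0.ne', Finset.card_univ] at mink
  refine le_trans ?_ mink
  rw [ENNReal.tsum_prod']
  refine ENNReal.tsum_le_tsum fun k => ENNReal.tsum_le_tsum fun l => ENNReal.rpow_le_rpow ?_ t0.le
  exact hK.normalizedIntegral_dyadicBox_le h𝓕 hr hq hω (he k l) i f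

/-- The factor of the maximal function coming from a rectangle. -/
theorem prod_inv_rpow_mul (α θ : ℝ) (hm : 0 < m) (hθ : θ = m - α / n)
    (R : Set (Fin n → ℝ)) (F : Fin m → ℝ≥0∞) :
    ∏ i, (((volume R) ^ (1 - α / ((m : ℝ) * (n : ℝ))))⁻¹ * F i) =
      (volume R ^ θ)⁻¹ * ∏ i, F i := by
  rw [Finset.prod_mul_distrib, Finset.prod_const, Finset.card_univ, Fintype.card_fin]
  congr 1
  rw [← ENNReal.rpow_neg, ← ENNReal.rpow_neg, ← ENNReal.rpow_natCast, ← ENNReal.rpow_mul, hθ]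
  congr 1
  have : (m : ℝ) ≠ 0 := by exact_mod_cast hm.ne'
  by_cases hn : (n : ℝ) = 0
  · simp [hn]
  · field_simp

/-- The weight condition is divided by the dual masses, which then normalize the integrals; if the
`ν_ω` mass is zero, both sides vanish. -/
theorem MultiWeightBound.rpow_mul_prodMass_le (hK : MultiWeightBound 𝓕 r q ω K)
    (h𝓕 : 𝓕 ⊆ rectangles n) (hr : ∀ i, 0 < r i) (hq : 0 < q)
    (hω : ∀ i, AEMeasurable (ω i) volume) {R : Set (Fin n → ℝ)} (hR : R ∈ 𝓕)
    (f : Fin m → (Fin n → ℝ) → ℝ) :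
    ((volume R ^ (1 / q + ∑ i, 1 / r i))⁻¹ * ∏ i, ∫⁻ y in R, ‖f i y‖ₑ) ^ q * prodMass q ω R ≤
      (K : ℝ≥0∞) ^ q * ∏ i, normalizedIntegral r q ω i (f i) R ^ q := by
  set θ := 1 / q + ∑ i, 1 / r i with hθ
  by_cases hN : prodMass q ω R = 0
  · simp [hN]
  have v0 := volume_ne_zero_of_mem_rectangles (h𝓕 hR)
  have v1 := volume_ne_top_of_mem_rectangles (h𝓕 hR)
  obtain ⟨-, St⟩ := hK.ne_top h𝓕 hr hq hω hR hN
  have cancel : ∀ i, dualMass (r i) (ω i) R ^ (1 / r i) * dualMass (r i) (ω i) R ^ (-(1 / r i)) =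
      1 := fun i => by
    rw [← ENNReal.rpow_add _ _ (dualMass_ne_zero (hr i) (hω i) v0) (St i), add_neg_cancel,
      ENNReal.rpow_zero]
  have e1 : prodMass q ω R ^ (1 / q) ≤
      K * volume R ^ θ * ∏ i, dualMass (r i) (ω i) R ^ (-(1 / r i)) := by
    calc _ = prodMass q ω R ^ (1 / q) * ∏ i, (dualMass (r i) (ω i) R ^ (1 / r i) *
            dualMass (r i) (ω i) R ^ (-(1 / r i))) := by simp_rw [cancel]; simp
      _ ≤ _ := by
        rw [Finset.prod_mul_distrib, ← mul_assoc]
        exact mul_le_mul_left (hK R hR) _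
  have e2 : prodMass q ω R = (prodMass q ω R ^ (1 / q)) ^ q := by
    rw [one_div, ENNReal.rpow_inv_rpow hq.ne']
  rw [e2, ENNReal.prod_rpow_of_nonneg hq.le, ← ENNReal.mul_rpow_of_nonneg _ _ hq.le,
    ← ENNReal.mul_rpow_of_nonneg _ _ hq.le]
  refine ENNReal.rpow_le_rpow ?_ hq.le
  calc _ ≤ (volume R ^ θ)⁻¹ * (∏ i, ∫⁻ y in R, ‖f i y‖ₑ) *
        (K * volume R ^ θ * ∏ i, dualMass (r i) (ω i) R ^ (-(1 / r i))) := by gcongr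
    _ = ((volume R ^ θ)⁻¹ * volume R ^ θ) * (K * ∏ i, (dualMass (r i) (ω i) R ^ (-(1 / r i)) *
        ∫⁻ y in R, ‖f i y‖ₑ)) := by rw [Finset.prod_mul_distrib]; ring
    _ = _ := by
      rw [ENNReal.inv_mul_cancel (by simp [v0, v1]) (ENNReal.rpow_ne_top_of_ne_zero v0 v1), one_mul]
      simp only [normalizedIntegral, hN, if_false]

/-- Hölder's inequality for sums of products in `[0, ∞]`. -/
theorem tsum_prod_rpow_le {κ : Type*} [Countable κ] (g : Fin m → κ → ℝ≥0∞) {c : Fin m → ℝ}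
    (hc : ∑ i, c i = 1) (hc0 : ∀ i, 0 ≤ c i) :
    ∑' y, ∏ i, g i y ^ c i ≤ ∏ i, (∑' y, g i y) ^ c i := by
  let : MeasurableSpace κ := ⊤
  have := ENNReal.lintegral_prod_norm_pow_le (μ := Measure.count) Finset.univ (f := g)
    (fun i _ => (measurable_from_top).aemeasurable) hc (fun i _ => hc0 i)
  simpa [lintegral_count] using this

theorem eLpNorm_powMeasure {P : ℝ} (hP : 0 < P) {w : (Fin n → ℝ) → ℝ≥0}
    (hw : AEMeasurable w volume) {f : (Fin n → ℝ) → ℝ} (hf : AEStronglyMeasurable f volume) :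
    eLpNorm f (ENNReal.ofReal P) (powMeasure w P) =
      (∫⁻ x, (w x : ℝ≥0∞) ^ P * ‖f x‖ₑ ^ P) ^ (1 / P) := by
  rw [eLpNorm_eq_lintegral_rpow_enorm_toReal (by simpa using hP) ENNReal.ofReal_ne_top,
    ENNReal.toReal_ofReal hP.le, powMeasure, lintegral_withDensity_eq_lintegral_mul₀
      (hw.coe_nnreal_ennreal.pow_const _) (hf.enorm.pow_const _)]
  rfl

theorem MultiWeightBound.exists_eLpNorm_maximalOp_le (hK : MultiWeightBound 𝓕 r q ω K)
    (h𝓕 : 𝓕 ⊆ rectangles n) (hd : dyadicRectangles n ⊆ 𝓕)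
    (hp : ∀ i, (p i).HolderConjugate (r i)) (hq : 0 < q)
    (hω : ∀ i, AEMeasurable (ω i) volume) {e : ℕ} (he : ∀ k l, dyadicBox e k l ∈ 𝓕)
    {α p₀ : ℝ} (hm : 0 < m) (hθ : 1 / q + ∑ i, 1 / r i = m - α / n) (hp₀ : 0 < p₀)
    (hpq : p₀ < q) (hsum : 1 / p₀ = ∑ i, 1 / p i) :
    ∃ C : ℝ≥0, ∀ f : Fin m → (Fin n → ℝ) → ℝ, (∀ i, AEStronglyMeasurable (f i) volume) →
      eLpNorm (maximalOp {R | ∃ k l, R = dyadicBox e k l} α f) (ENNReal.ofReal q)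
        (powMeasure (prodWeight ω) q) ≤
      C * ∏ i, eLpNorm (f i) (ENNReal.ofReal (p i)) (powMeasure (ω i) (p i)) := by
  have hr : ∀ i, 0 < r i := fun i => (hp i).symm.pos
  have hs : 1 < q / p₀ := (one_lt_div hp₀).2 hpq
  choose C hC using hK.exists_tsum_dyadicBox_le h𝓕 hd hp hq hω hs he
  have c0 : ∀ i, 0 ≤ p₀ / p i := fun i => by have := (hp i).pos; positivity
  refine ⟨K * ∏ i, (C i) ^ (p₀ / p i / q), fun f hf => ?_⟩
  set Φ : Fin m → ℝ≥0∞ := fun i => ∫⁻ x, (ω i x : ℝ≥0∞) ^ p i * ‖f i x‖ₑ ^ p i with hΦ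
  set a : (Fin n → ℤ) × (Fin n → ℤ) → ℝ≥0∞ := fun y =>
    (volume (dyadicBox e y.1 y.2) ^ (1 / q + ∑ i, 1 / r i))⁻¹ *
      ∏ i, ∫⁻ x in dyadicBox e y.1 y.2, ‖f i x‖ₑ with ha
  -- The supremum of the `q`-th powers is bounded by their sum over all boxes containing `x`; the
  -- strong decay in the embedding estimate makes this affordable.
  have pt : ∀ x, maximalOp {R | ∃ k l, R = dyadicBox e k l} α f x ^ q ≤
      ∑' y : (Fin n → ℤ) × (Fin n → ℤ), (dyadicBox e y.1 y.2).indicator (fun _ => a y ^ q) x := by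
    intro x
    rw [← ENNReal.le_rpow_inv_iff hq]
    refine iSup₂_le fun R hR => iSup_le fun hx => ?_
    obtain ⟨k, l, rfl⟩ := hR
    rw [ENNReal.le_rpow_inv_iff hq, prod_inv_rpow_mul α _ hm hθ]
    refine le_trans (le_of_eq ?_) (ENNReal.le_tsum (k, l))
    rw [Set.indicator_of_mem hx]
  have meas : ∀ y : (Fin n → ℤ) × (Fin n → ℤ), powMeasure (prodWeight ω) q (dyadicBox e y.1 y.2) =
      prodMass q ω (dyadicBox e y.1 y.2) := fun y =>
    withDensity_apply _ (measurableSet_dyadicBox e _ _)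
  have tot : ∀ i, ∑' y : (Fin n → ℤ) × (Fin n → ℤ),
      normalizedIntegral r q ω i (f i) (dyadicBox e y.1 y.2) ^ (p i * (q / p₀)) ≤
        C i * Φ i ^ (q / p₀) := by
    intro i
    rw [ENNReal.tsum_prod']
    exact hC i (f i) (hf i)
  have main : ∫⁻ x, maximalOp {R | ∃ k l, R = dyadicBox e k l} α f x ^ q
      ∂powMeasure (prodWeight ω) q ≤
      (K : ℝ≥0∞) ^ q * ∏ i, (C i * Φ i ^ (q / p₀)) ^ (p₀ / p i) := by
    calc _ ≤ ∫⁻ x, ∑' y : (Fin n → ℤ) × (Fin n → ℤ),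
            (dyadicBox e y.1 y.2).indicator (fun _ => a y ^ q) x ∂powMeasure (prodWeight ω) q :=
          lintegral_mono pt
      _ = ∑' y : (Fin n → ℤ) × (Fin n → ℤ), a y ^ q * prodMass q ω (dyadicBox e y.1 y.2) := by
          rw [lintegral_tsum fun y =>
            (measurable_const.indicator (measurableSet_dyadicBox e _ _)).aemeasurable]
          refine tsum_congr fun y => ?_
          rw [lintegral_indicator_const (measurableSet_dyadicBox e _ _), meas]
      _ ≤ ∑' y : (Fin n → ℤ) × (Fin n → ℤ), (K : ℝ≥0∞) ^ q *
            ∏ i, normalizedIntegral r q ω i (f i) (dyadicBox e y.1 y.2) ^ q :=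
          ENNReal.tsum_le_tsum fun y => hK.rpow_mul_prodMass_le h𝓕 hr hq hω (he _ _) f
      _ = (K : ℝ≥0∞) ^ q * ∑' y : (Fin n → ℤ) × (Fin n → ℤ),
            ∏ i, (normalizedIntegral r q ω i (f i) (dyadicBox e y.1 y.2) ^
              (p i * (q / p₀))) ^ (p₀ / p i) := by
          rw [ENNReal.tsum_mul_left]
          congr 1
          refine tsum_congr fun y => Finset.prod_congr rfl fun i _ => ?_
          rw [← ENNReal.rpow_mul]
          congr 1
          have := (hp i).ne_zero
          field_simp
      _ ≤ (K : ℝ≥0∞) ^ q * ∏ i, (∑' y : (Fin n → ℤ) × (Fin n → ℤ),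
            normalizedIntegral r q ω i (f i) (dyadicBox e y.1 y.2) ^
              (p i * (q / p₀))) ^ (p₀ / p i) := by
          gcongr
          refine tsum_prod_rpow_le _ ?_ c0
          simp_rw [div_eq_mul_one_div p₀ (p _)]
          rw [← Finset.mul_sum, ← hsum, mul_one_div_cancel hp₀.ne']
      _ ≤ _ := by
          gcongr with i
          · exact c0 i
          · exact tot i
  rw [eLpNorm_eq_lintegral_rpow_enorm_toReal (by simpa using hq) ENNReal.ofReal_ne_top,
    ENNReal.toReal_ofReal hq.le]
  simp only [enorm_eq_self]
  refine (ENNReal.rpow_le_rpow main (by positivity)).trans_eq ?_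
  have iq : 0 ≤ 1 / q := by positivity
  rw [ENNReal.mul_rpow_of_nonneg _ _ iq, ← ENNReal.rpow_mul, mul_one_div_cancel hq.ne',
    ENNReal.rpow_one, ← ENNReal.prod_rpow_of_nonneg iq, ENNReal.coe_mul,
    ENNReal.ofNNReal_finsetProd, mul_assoc, ← Finset.prod_mul_distrib]
  congr 1
  refine Finset.prod_congr rfl fun i _ => ?_
  have hpi := (hp i).pos
  rw [eLpNorm_powMeasure hpi (hω i) (hf i), ENNReal.coe_rpow_of_nonneg _ (by positivity),
    ENNReal.mul_rpow_of_nonneg _ _ (c0 i), ENNReal.mul_rpow_of_nonneg _ _ iq,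
    ← ENNReal.rpow_mul, ← ENNReal.rpow_mul, ← ENNReal.rpow_mul]
  congr 2
  · ring
  · field_simp

theorem maximalOp_rectangles_le (α θ : ℝ) (hm : 0 < m) (hθ : θ = m - α / n) (hθ0 : 0 ≤ θ)
    (f : Fin m → (Fin n → ℝ) → ℝ) (x : Fin n → ℝ) :
    maximalOp (rectangles n) α f x ≤
      ((4 : ℝ≥0∞) ^ n) ^ θ * maximalOp {R | ∃ k l, R = dyadicBox 2 k l} α f x := by
  refine iSup₂_le fun R hR => iSup_le fun hx => ?_
  obtain ⟨k, l, hsub, hvol⟩ := exists_subset_dyadicBox_two hR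
  have v0 := volume_ne_zero_of_mem_rectangles hR
  have v1 := volume_ne_top_of_mem_rectangles hR
  have mem := dyadicBox_mem_rectangles (n := n) two_pos k l
  have w0 := volume_ne_zero_of_mem_rectangles mem
  have w1 := volume_ne_top_of_mem_rectangles mem
  have le : ∏ i, (((volume (dyadicBox 2 k l)) ^ (1 - α / ((m : ℝ) * (n : ℝ))))⁻¹ *
      ∫⁻ y in dyadicBox 2 k l, ‖f i y‖ₑ) ≤ maximalOp {R | ∃ k l, R = dyadicBox 2 k l} α f x :=
    le_iSup₂_of_le (dyadicBox 2 k l) ⟨k, l, rfl⟩ (le_iSup_of_le (hsub hx) le_rfl)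
  refine le_trans ?_ (mul_le_mul_right le _)
  rw [prod_inv_rpow_mul α θ hm hθ, prod_inv_rpow_mul α θ hm hθ, ← mul_assoc]
  refine mul_le_mul' ?_ (Finset.prod_le_prod' fun i _ => lintegral_mono_set hsub)
  rw [← div_eq_mul_inv, ENNReal.le_div_iff_mul_le (by simp [w0, w1])
    (by left; exact ENNReal.rpow_ne_top_of_ne_zero w0 w1), ENNReal.inv_mul_le_iff
    (by simp [v0, v1]) (ENNReal.rpow_ne_top_of_ne_zero v0 v1),
    ← ENNReal.mul_rpow_of_nonneg _ _ hθ0, mul_comm]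
  exact ENNReal.rpow_le_rpow hvol hθ0

end Sufficiency

/-! ### Measurability, strong to weak type, and necessity of the weight condition -/

section Necessity

variable {p r : Fin m → ℝ} {q : ℝ} {ω : Fin m → (Fin n → ℝ) → ℝ≥0}
  {𝓕 : Set (Set (Fin n → ℝ))}

theorem measurable_maximalOp_dyadicRectangles (α : ℝ) (f : Fin m → (Fin n → ℝ) → ℝ) :
    Measurable (maximalOp (dyadicRectangles n) α f) := by
  refine Measurable.biSup _ ?_ fun R hR => ?_
  · refine (Set.countable_range fun y : (Fin n → ℤ) × (Fin n → ℤ) => dyadicBox 1 y.1 y.2).mono ?_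
    intro R hR
    obtain ⟨k, l, rfl⟩ := mem_dyadicRectangles.1 hR
    exact ⟨(k, l), rfl⟩
  · classical
    simp_rw [iSup_eq_if]
    exact Measurable.ite (measurableSet_of_mem_rectangles (dyadicRectangles_subset_rectangles hR))
      measurable_const measurable_const

/-- Moving the left faces of a half-open rectangle outwards by `ε` makes it a neighbourhood of each
point of the original. The integrals only grow and the volume changes little, so a strict lower
bound survives. -/
theorem lowerSemicontinuous_maximalOp_rectangles (α : ℝ) (hm : 0 < m)
    (f : Fin m → (Fin n → ℝ) → ℝ) : LowerSemicontinuous (maximalOp (rectangles n) α f) := by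
  intro x t ht
  simp only [maximalOp, lt_iSup_iff] at ht
  obtain ⟨R, hR, hx, ht⟩ := ht
  obtain ⟨a, b, hab, rfl⟩ := id hR
  rw [prod_inv_rpow_mul α _ hm rfl] at ht
  set θ : ℝ := m - α / n
  set F := ∏ i, ∫⁻ y in Set.univ.pi fun j => Set.Ico (a j) (b j), ‖f i y‖ₑ with hF
  let c : ℝ → ℝ≥0∞ := fun ε => ((∏ j, ENNReal.ofReal (b j - (a j - ε))) ^ θ)⁻¹ * F
  have c0 : c 0 = ((volume (Set.univ.pi fun j => Set.Ico (a j) (b j))) ^ θ)⁻¹ * F := by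
    simp only [c, sub_zero, Real.volume_pi_Ico]
  have hc : Filter.Tendsto c (nhds 0) (nhds (c 0)) := by
    refine ENNReal.Tendsto.mul_const ?_ (Or.inl ?_)
    · refine Filter.Tendsto.inv ((ENNReal.continuous_rpow_const.tendsto _).comp ?_)
      refine ENNReal.tendsto_finsetProd_of_ne_top _ ?_ ?_
      · intro j _
        exact (ENNReal.continuous_ofReal.comp (by fun_prop)).tendsto 0
      · exact fun j _ => ENNReal.ofReal_ne_top
    -- `F` may be infinite, so continuity of the product needs a nonzero limit of the volume factor.
    · simp only [sub_zero, ← Real.volume_pi_Ico]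
      exact ENNReal.inv_ne_zero.2 (ENNReal.rpow_ne_top_of_ne_zero
        (volume_ne_zero_of_mem_rectangles hR) (volume_ne_top_of_mem_rectangles hR))
  have hev := (hc.eventually (lt_mem_nhds (c0 ▸ ht))).filter_mono
    (nhdsWithin_le_nhds (s := Set.Ioi (0 : ℝ)))
  obtain ⟨ε, hε, hε0⟩ := (hev.and self_mem_nhdsWithin).exists
  have hε0 : 0 < ε := hε0
  have hmem : (Set.univ.pi fun j => Set.Ioo (a j - ε) (b j)) ∈ nhds x := by
    refine set_pi_mem_nhds Set.finite_univ fun j _ => Ioo_mem_nhds ?_ ?_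
    · have := (hx j (Set.mem_univ j)).1
      linarith
    · exact (hx j (Set.mem_univ j)).2
  filter_upwards [hmem] with y hy
  have hR' : (Set.univ.pi fun j => Set.Ico (a j - ε) (b j)) ∈ rectangles n :=
    ⟨fun j => a j - ε, b, fun j => by have := hab j; simp only; linarith, rfl⟩
  have hy' : y ∈ Set.univ.pi fun j => Set.Ico (a j - ε) (b j) :=
    fun j hj => Set.Ioo_subset_Ico_self (hy j hj)
  refine hε.trans_le (le_trans ?_ (le_iSup₂_of_le _ hR' (le_iSup_of_le hy' le_rfl)))
  rw [prod_inv_rpow_mul α _ hm rfl, Real.volume_pi_Ico]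
  refine mul_le_mul_right (Finset.prod_le_prod' fun i _ => lintegral_mono_set ?_) _
  exact Set.pi_mono fun j _ => Set.Ico_subset_Ico_left (by linarith)

theorem weakNorm_le_eLpNorm {g : (Fin n → ℝ) → ℝ≥0∞} (hg : Measurable g) (hq : 0 < q)
    (μ : Measure (Fin n → ℝ)) : weakNorm g q μ ≤ eLpNorm g (ENNReal.ofReal q) μ := by
  refine iSup_le fun t => ?_
  rw [eLpNorm_eq_lintegral_rpow_enorm_toReal (by simpa using hq) ENNReal.ofReal_ne_top,
    ENNReal.toReal_ofReal hq.le]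
  simp only [enorm_eq_self]
  have iq : 0 ≤ 1 / q := by positivity
  have e : (t : ℝ≥0∞) = ((t : ℝ≥0∞) ^ q) ^ (1 / q) := by
    rw [one_div, ENNReal.rpow_rpow_inv hq.ne']
  rw [e, ← ENNReal.mul_rpow_of_nonneg _ _ iq]
  refine ENNReal.rpow_le_rpow ?_ iq
  refine le_trans (mul_le_mul_right (measure_mono fun x hx => ?_) _)
    (mul_meas_ge_le_lintegral (hg.pow_const q) ((t : ℝ≥0∞) ^ q))
  rw [one_div, ENNReal.rpow_rpow_inv hq.ne'] at hx
  exact ENNReal.rpow_le_rpow (le_of_lt hx) hq.le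

theorem StrongBounded.weakBounded {α : ℝ} (h : StrongBounded 𝓕 α p q ω) (hq : 0 < q)
    (hM : ∀ f : Fin m → (Fin n → ℝ) → ℝ, Measurable (maximalOp 𝓕 α f)) :
    WeakBounded 𝓕 α p q ω := by
  obtain ⟨C, hC⟩ := h
  exact ⟨C, fun f h1 h2 => (weakNorm_le_eLpNorm (hM f) hq _).trans (hC f h1 h2)⟩

theorem prod_iSup_le_iSup_prod {ι : Type*} (t : Finset ι) {u : ι → ℕ → ℝ≥0∞}
    (hu : ∀ i, Monotone (u i)) : ∏ i ∈ t, ⨆ k, u i k ≤ ⨆ k, ∏ i ∈ t, u i k := by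
  classical
  induction t using Finset.induction_on with
  | empty => simp
  | insert a t ha ih =>
    simp_rw [Finset.prod_insert ha]
    refine (mul_le_mul_right ih _).trans ?_
    simp_rw [ENNReal.iSup_mul, ENNReal.mul_iSup]
    refine iSup_le fun k => iSup_le fun l => le_iSup_of_le (max k l) ?_
    exact mul_le_mul' (hu a (le_max_left _ _))
      (Finset.prod_le_prod' fun i _ => hu i (le_max_right _ _))

/-- Truncations of the dual weight. -/
noncomputable def truncatedDual (r : ℝ) (w : (Fin n → ℝ) → ℝ≥0) (k : ℕ) (x : Fin n → ℝ) : ℝ≥0∞ :=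
  min ((w x : ℝ≥0∞) ^ (-r)) ((k : ℝ≥0∞) + 1)

section Truncation

variable {P r : ℝ} {w : (Fin n → ℝ) → ℝ≥0}

theorem truncatedDual_ne_top (k : ℕ) (x : Fin n → ℝ) : truncatedDual r w k x ≠ ∞ :=
  ne_top_of_le_ne_top (by simp) (min_le_right _ _)

/-- The `+ 1` in the truncation level keeps the level `k = 0` positive, so that the integrals of
truncations can later be cancelled. -/
theorem truncatedDual_ne_zero (hr : 0 < r) (k : ℕ) (x : Fin n → ℝ) :
    truncatedDual r w k x ≠ 0 := by
  have h1 : (w x : ℝ≥0∞) ^ (-r) ≠ 0 := by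
    rw [Ne, ENNReal.rpow_eq_zero_iff]
    rintro (h | h)
    · linarith [h.2]
    · exact ENNReal.coe_ne_top h.1
  exact (lt_min (pos_iff_ne_zero.2 h1) (by positivity)).ne'

theorem aemeasurable_truncatedDual (hw : AEMeasurable w volume) (k : ℕ) :
    AEMeasurable (truncatedDual r w k) volume :=
  (hw.coe_nnreal_ennreal.pow_const _).min aemeasurable_const

theorem monotone_truncatedDual (x : Fin n → ℝ) : Monotone fun k => truncatedDual r w k x := by
  intro k l h
  exact min_le_min le_rfl (by gcongr)

theorem iSup_truncatedDual (x : Fin n → ℝ) : ⨆ k, truncatedDual r w k x = (w x : ℝ≥0∞) ^ (-r) := by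
  have top : ⨆ k : ℕ, ((k : ℝ≥0∞) + 1) = ∞ := by
    refine eq_top_iff.2 (ENNReal.iSup_natCast.ge.trans (iSup_mono fun k => le_self_add))
  simp only [truncatedDual]
  rw [← inf_iSup_eq, top, inf_top_eq]

/-- Since `r (P - 1) = P`, the full dual weight `w ^ (-r)` would give equality where `w ≠ 0`;
truncating lowers only the factor with exponent `P - 1`. -/
theorem rpow_mul_truncatedDual_rpow_le (hp : P.HolderConjugate r) (k : ℕ) (x : Fin n → ℝ) :
    (w x : ℝ≥0∞) ^ P * truncatedDual r w k x ^ P ≤ truncatedDual r w k x := by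
  have P1 : 0 ≤ P - 1 := by linarith [hp.lt]
  have e1 : truncatedDual r w k x ^ P =
      truncatedDual r w k x ^ (P - 1) * truncatedDual r w k x := by
    nth_rewrite 3 [← ENNReal.rpow_one (truncatedDual r w k x)]
    rw [← ENNReal.rpow_add_of_nonneg _ _ P1 zero_le_one, sub_add_cancel]
  have e2 : (w x : ℝ≥0∞) ^ P * truncatedDual r w k x ^ (P - 1) ≤ 1 := by
    calc _ ≤ (w x : ℝ≥0∞) ^ P * ((w x : ℝ≥0∞) ^ (-r)) ^ (P - 1) := by
          gcongr
          exact min_le_left _ _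
      _ = (w x : ℝ≥0∞) ^ P * ((w x : ℝ≥0∞) ^ P)⁻¹ := by
          rw [← ENNReal.rpow_mul, ← ENNReal.rpow_neg]
          congr 2
          have := hp.symm.sub_one_mul_conj
          have := hp.mul_eq_add
          linarith
      _ ≤ 1 := ENNReal.mul_inv_le_one _
  rw [e1, ← mul_assoc]
  exact (mul_le_mul_left e2 _).trans_eq (one_mul _)

theorem iSup_lintegral_truncatedDual (hw : AEMeasurable w volume) (R : Set (Fin n → ℝ)) :
    ⨆ k, ∫⁻ x in R, truncatedDual r w k x = dualMass r w R := by
  rw [← lintegral_iSup' (fun k => (aemeasurable_truncatedDual hw k).restrict)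
    (Filter.Eventually.of_forall fun x => monotone_truncatedDual x)]
  simp_rw [iSup_truncatedDual]
  rfl

theorem lintegral_truncatedDual_ne_top {R : Set (Fin n → ℝ)} (hR : volume R ≠ ∞) (k : ℕ) :
    ∫⁻ x in R, truncatedDual r w k x ≠ ∞ := by
  refine ne_top_of_le_ne_top ?_ (lintegral_mono fun x => min_le_right _ _)
  rw [setLIntegral_const]
  exact ENNReal.mul_ne_top (by simp) hR

theorem lintegral_truncatedDual_ne_zero (hr : 0 < r) (hw : AEMeasurable w volume)
    {R : Set (Fin n → ℝ)} (hR : volume R ≠ 0) (k : ℕ) :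
    ∫⁻ x in R, truncatedDual r w k x ≠ 0 := by
  intro h
  rw [lintegral_eq_zero_iff' (aemeasurable_truncatedDual hw k).restrict] at h
  have : ∀ᵐ x ∂(volume.restrict R), False := by
    filter_upwards [h] with x hx using truncatedDual_ne_zero hr k x hx
  simp [hR] at this

/-- The functions on which the weak type inequality is tested. -/
noncomputable def testFunction (r : ℝ) (w : (Fin n → ℝ) → ℝ≥0) (k : ℕ) (R : Set (Fin n → ℝ)) :
    (Fin n → ℝ) → ℝ :=
  R.indicator fun x => (truncatedDual r w k x).toReal

theorem enorm_testFunction (k : ℕ) (R : Set (Fin n → ℝ)) (x : Fin n → ℝ) :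
    ‖testFunction r w k R x‖ₑ = R.indicator (truncatedDual r w k) x := by
  rw [testFunction, enorm_indicator_eq_indicator_enorm]
  refine congrFun (congrArg _ (funext fun x => ?_)) x
  rw [Real.enorm_eq_ofReal ENNReal.toReal_nonneg, ENNReal.ofReal_toReal (truncatedDual_ne_top k x)]

theorem integrable_testFunction (hw : AEMeasurable w volume) {R : Set (Fin n → ℝ)}
    (hR : MeasurableSet R) (hR' : volume R ≠ ∞) (k : ℕ) :
    Integrable (testFunction r w k R) volume := by
  refine ⟨((aemeasurable_truncatedDual hw k).ennreal_toReal.indicator hR).aestronglyMeasurable, ?_⟩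
  rw [HasFiniteIntegral]
  simp_rw [enorm_testFunction]
  rw [lintegral_indicator hR]
  exact (lintegral_truncatedDual_ne_top hR' k).lt_top

theorem eLpNorm_testFunction_le (hp : P.HolderConjugate r) (hw : AEMeasurable w volume)
    {R : Set (Fin n → ℝ)} (hR : MeasurableSet R) (hR' : volume R ≠ ∞) (k : ℕ) :
    eLpNorm (testFunction r w k R) (ENNReal.ofReal P) (powMeasure w P) ≤
      (∫⁻ x in R, truncatedDual r w k x) ^ (1 / P) := by
  have hP := hp.pos
  rw [eLpNorm_powMeasure hP hw (integrable_testFunction hw hR hR' k).1]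
  refine ENNReal.rpow_le_rpow ?_ (by positivity)
  rw [← lintegral_indicator hR]
  refine lintegral_mono fun x => ?_
  simp only [enorm_testFunction]
  by_cases hx : x ∈ R
  · simpa only [Set.indicator_of_mem hx] using rpow_mul_truncatedDual_rpow_le hp k x
  · simp [Set.indicator_of_notMem hx, hP]

end Truncation

/-- For `fᵢ` the truncated dual weight on `R`, the maximal function is at least the average over `R`
throughout `R`. Truncation makes the test functions admissible and the cancellation legitimate;
monotone convergence then removes it. -/
theorem WeakBounded.exists_multiWeightBound {α : ℝ} (h : WeakBounded 𝓕 α p q ω)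
    (h𝓕 : 𝓕 ⊆ rectangles n) (hp : ∀ i, (p i).HolderConjugate (r i)) (hq : 0 < q)
    (hω : ∀ i, AEMeasurable (ω i) volume) (hm : 0 < m)
    (hθ : 1 / q + ∑ i, 1 / r i = m - α / n) :
    ∃ K : ℝ≥0, MultiWeightBound 𝓕 r q ω K := by
  obtain ⟨C, hC⟩ := h
  refine ⟨C, fun R hR => ?_⟩
  set θ := 1 / q + ∑ i, 1 / r i
  have hr : ∀ i, 0 < r i := fun i => (hp i).symm.pos
  have hR₀ := measurableSet_of_mem_rectangles (h𝓕 hR)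
  have v0 := volume_ne_zero_of_mem_rectangles (h𝓕 hR)
  have v1 := volume_ne_top_of_mem_rectangles (h𝓕 hR)
  let S : Fin m → ℕ → ℝ≥0∞ := fun i k => ∫⁻ x in R, truncatedDual (r i) (ω i) k x
  have S0 : ∀ i k, S i k ≠ 0 := fun i k => lintegral_truncatedDual_ne_zero (hr i) (hω i) v0 k
  have S1 : ∀ i k, S i k ≠ ∞ := fun i k => lintegral_truncatedDual_ne_top v1 k
  have step : ∀ k, prodMass q ω R ^ (1 / q) * ∏ i, S i k ^ (1 / r i) ≤ C * volume R ^ θ := by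
    intro k
    let f : Fin m → (Fin n → ℝ) → ℝ := fun i => testFunction (r i) (ω i) k R
    have hle : ∀ i, eLpNorm (f i) (ENNReal.ofReal (p i)) (powMeasure (ω i) (p i)) ≤
        S i k ^ (1 / p i) := fun i => eLpNorm_testFunction_le (hp i) (hω i) hR₀ v1 k
    have hint : ∀ i, Integrable (f i) volume := fun i => integrable_testFunction (hω i) hR₀ v1 k
    have hweak := hC f (fun i => (hint i).locallyIntegrable) fun i =>
      ⟨(hint i).1.mono_ac (withDensity_absolutelyContinuous _ _), (hle i).trans_lt
        (ENNReal.rpow_lt_top_of_nonneg (by have := (hp i).pos; positivity) (S1 i k))⟩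
    have hF : ∀ i, ∫⁻ y in R, ‖f i y‖ₑ = S i k := by
      intro i
      simp only [f, enorm_testFunction]
      rw [setLIntegral_indicator hR₀, Set.inter_self]
    have hmul : ((volume R ^ θ)⁻¹ * ∏ i, S i k) * prodMass q ω R ^ (1 / q) ≤
        C * ∏ i, S i k ^ (1 / p i) := by
      -- The weak norm uses strict superlevel sets, so `t` must stay strictly below the average over
      -- `R`.
      refine ENNReal.mul_le_of_forall_lt fun t ht b hb => ?_
      lift t to ℝ≥0 using ht.ne_top
      have hsub : R ⊆ {x | (t : ℝ≥0∞) < maximalOp 𝓕 α f x} := by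
        intro x hx
        refine ht.trans_le (le_iSup₂_of_le R hR (le_iSup_of_le hx ?_))
        rw [prod_inv_rpow_mul α θ hm hθ]
        simp only [hF, le_refl]
      have hmass : prodMass q ω R ≤
          powMeasure (prodWeight ω) q {x | (t : ℝ≥0∞) < maximalOp 𝓕 α f x} := by
        refine le_trans (le_of_eq ?_) (measure_mono hsub)
        rw [powMeasure, withDensity_apply _ hR₀, prodMass]
      calc (t : ℝ≥0∞) * b ≤ t * (powMeasure (prodWeight ω) q
            {x | (t : ℝ≥0∞) < maximalOp 𝓕 α f x}) ^ (1 / q) := by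
            gcongr
            exact hb.le.trans (ENNReal.rpow_le_rpow hmass (by positivity))
        _ ≤ weakNorm (maximalOp 𝓕 α f) q (powMeasure (prodWeight ω) q) :=
            le_iSup (fun t : ℝ≥0 => (t : ℝ≥0∞) * (powMeasure (prodWeight ω) q
              {x | (t : ℝ≥0∞) < maximalOp 𝓕 α f x}) ^ (1 / q)) t
        _ ≤ _ := hweak.trans (mul_le_mul_right (Finset.prod_le_prod' fun i _ => hle i) _)
    have hsplit : ∏ i, S i k = (∏ i, S i k ^ (1 / p i)) * ∏ i, S i k ^ (1 / r i) := by
      rw [← Finset.prod_mul_distrib]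
      refine Finset.prod_congr rfl fun i _ => ?_
      rw [← ENNReal.rpow_add _ _ (S0 i k) (S1 i k), one_div, one_div, (hp i).inv_add_inv_eq_one,
        ENNReal.rpow_one]
    have A0 : ∏ i, S i k ^ (1 / p i) ≠ 0 := Finset.prod_ne_zero_iff.2 fun i _ => by
      simp [S0 i k, (hp i).nonneg]
    have A1 : ∏ i, S i k ^ (1 / p i) ≠ ∞ := ENNReal.prod_ne_top fun i _ =>
      ENNReal.rpow_ne_top_of_nonneg (by have := (hp i).pos; positivity) (S1 i k)
    refine (ENNReal.mul_le_mul_iff_right A0 A1).1 ?_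
    have w0 : volume R ^ θ ≠ 0 := by simp [v0, v1]
    have w1 : volume R ^ θ ≠ ∞ := ENNReal.rpow_ne_top_of_ne_zero v0 v1
    calc _ = volume R ^ θ * (((volume R ^ θ)⁻¹ * ∏ i, S i k) * prodMass q ω R ^ (1 / q)) := by
          rw [mul_assoc ((volume R ^ θ)⁻¹), ENNReal.mul_inv_cancel_left w0 w1, hsplit]
          ring
      _ ≤ volume R ^ θ * (C * ∏ i, S i k ^ (1 / p i)) := by gcongr
      _ = _ := by ring
  have hlim : ∀ i, dualMass (r i) (ω i) R ^ (1 / r i) = ⨆ k, S i k ^ (1 / r i) := by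
    intro i
    rw [← iSup_lintegral_truncatedDual (hω i)]
    have hi : 0 < 1 / r i := by have := hr i; positivity
    exact (ENNReal.orderIsoRpow _ hi).map_iSup _
  have hmono : ∀ i, Monotone fun k => S i k ^ (1 / r i) := by
    intro i k l hkl
    have hi : 0 ≤ 1 / r i := by have := hr i; positivity
    exact ENNReal.rpow_le_rpow (lintegral_mono fun x => monotone_truncatedDual x hkl) hi
  simp_rw [hlim]
  refine (mul_le_mul_right (prod_iSup_le_iSup_prod _ hmono) _).trans ?_
  rw [ENNReal.mul_iSup]
  exact iSup_le step

theorem exponent_identity {α p₀ : ℝ} (hp : ∀ i, (p i).HolderConjugate (r i))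
    (hp₀ : 1 / p₀ = ∑ i, 1 / p i) (hq : 1 / q = 1 / p₀ - α / n) :
    1 / q + ∑ i, 1 / r i = m - α / n := by
  have : ∑ i, 1 / r i = m - 1 / p₀ := by
    rw [hp₀, eq_sub_iff_add_eq, ← Finset.sum_add_distrib]
    simp [fun i => (add_comm _ _).trans (hp i).inv_add_inv_eq_one]
  rw [this, hq]
  ring

end Necessity

end StrongMaximal

/-! ### Assembly of the equivalences -/

theorem theorem2p2 (m n : ℕ) (α : ℝ) (hα : 0 < α) (hαmn : α < (m : ℝ) * (n : ℝ))
    (p : Fin m → ℝ) (hp : ∀ i, 1 < p i)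
    (p₀ q : ℝ) (hp₀ : 1 / p₀ = ∑ i, 1 / p i)
    (hpq : p₀ < q) (hq : 1 / q = 1 / p₀ - α / (n : ℝ))
    (ω : Fin m → (Fin n → ℝ) → ℝ≥0) (hω : ∀ i, AEMeasurable (ω i) volume) :
    ((StrongMaximal.MultiWeightClass (StrongMaximal.rectangles n) p q ω ↔
        StrongMaximal.WeakBounded (StrongMaximal.rectangles n) α p q ω) ∧
      (StrongMaximal.MultiWeightClass (StrongMaximal.rectangles n) p q ω ↔
        StrongMaximal.StrongBounded (StrongMaximal.rectangles n) α p q ω)) ∧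
    ((StrongMaximal.MultiWeightClass (StrongMaximal.dyadicRectangles n) p q ω ↔
        StrongMaximal.WeakBounded (StrongMaximal.dyadicRectangles n) α p q ω) ∧
      (StrongMaximal.MultiWeightClass (StrongMaximal.dyadicRectangles n) p q ω ↔
        StrongMaximal.StrongBounded (StrongMaximal.dyadicRectangles n) α p q ω)) := by
  open StrongMaximal in
  have hm : 0 < m := by
    rcases Nat.eq_zero_or_pos m with rfl | h
    · simp at hαmn
      linarith
    · exact h
  have hc : ∀ i, (p i).HolderConjugate (p i).conjExponent := fun i =>
    Real.HolderConjugate.conjExponent (hp i)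
  have hp₀' : 0 < p₀ := by
    have : Nonempty (Fin m) := ⟨⟨0, hm⟩⟩
    have : 0 < 1 / p₀ := hp₀ ▸ Finset.sum_pos
      (fun i _ => by have := (hc i).pos; positivity) Finset.univ_nonempty
    exact one_div_pos.1 this
  have hq0 : 0 < q := hp₀'.trans hpq
  have hθ := exponent_identity (n := n) hc hp₀ hq
  have hθ0 : 0 ≤ 1 / q + ∑ i, 1 / (p i).conjExponent := by
    have : 0 ≤ ∑ i, 1 / (p i).conjExponent :=
      Finset.sum_nonneg fun i _ => by have := (hc i).symm.pos; positivity
    positivity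
  have hdy := dyadicRectangles_subset_rectangles (n := n)
  have necessity : ∀ 𝓕 ⊆ rectangles n, WeakBounded 𝓕 α p q ω → MultiWeightClass 𝓕 p q ω :=
    fun 𝓕 h𝓕 h => (multiWeightClass_iff h𝓕 hp hq0 ω).2
      (h.exists_multiWeightBound h𝓕 hc hq0 hω hm hθ)
  have weak : StrongBounded (rectangles n) α p q ω → WeakBounded (rectangles n) α p q ω :=
    fun h => h.weakBounded hq0 fun f => (lowerSemicontinuous_maximalOp_rectangles α hm f).measurable
  have weak_dyadic : StrongBounded (dyadicRectangles n) α p q ω →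
      WeakBounded (dyadicRectangles n) α p q ω :=
    fun h => h.weakBounded hq0 fun f => measurable_maximalOp_dyadicRectangles α f
  have strong : MultiWeightClass (rectangles n) p q ω →
      StrongBounded (rectangles n) α p q ω := by
    intro h
    obtain ⟨K, hK⟩ := (multiWeightClass_iff subset_rfl hp hq0 ω).1 h
    obtain ⟨C, hC⟩ := hK.exists_eLpNorm_maximalOp_le subset_rfl hdy hc hq0 hω
      (fun k l => dyadicBox_mem_rectangles two_pos k l) hm hθ hp₀' hpq hp₀
    -- The factor `(4 ^ n) ^ θ` is the cost of enlarging a rectangle to a box of two dyadic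
    -- intervals per side.
    refine ⟨((4 : ℝ≥0) ^ n) ^ (1 / q + ∑ i, 1 / (p i).conjExponent) * C, fun f hf _ => ?_⟩
    have hle := eLpNorm_le_nnreal_smul_eLpNorm_of_ae_le_mul' (p := ENNReal.ofReal q)
      (μ := powMeasure (prodWeight ω) q)
      (c := ((4 : ℝ≥0) ^ n) ^ (1 / q + ∑ i, 1 / (p i).conjExponent))
      (f := maximalOp (rectangles n) α f)
      (g := maximalOp {R | ∃ k l, R = dyadicBox 2 k l} α f)
      (Filter.Eventually.of_forall fun x => by
        rw [ENNReal.coe_rpow_of_nonneg _ hθ0]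
        exact_mod_cast maximalOp_rectangles_le α _ hm hθ hθ0 f x)
    refine hle.trans ?_
    rw [ENNReal.smul_def, smul_eq_mul, ENNReal.coe_mul, mul_assoc]
    exact mul_le_mul_right (hC f fun i => (hf i).aestronglyMeasurable) _
  have strong_dyadic : MultiWeightClass (dyadicRectangles n) p q ω →
      StrongBounded (dyadicRectangles n) α p q ω := by
    intro h
    obtain ⟨K, hK⟩ := (multiWeightClass_iff hdy hp hq0 ω).1 h
    obtain ⟨C, hC⟩ := hK.exists_eLpNorm_maximalOp_le hdy subset_rfl hc hq0 hω
      dyadicBox_mem_dyadicRectangles hm hθ hp₀' hpq hp₀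
    have heq : dyadicRectangles n = {R | ∃ k l, R = dyadicBox 1 k l} :=
      Set.ext fun R => mem_dyadicRectangles
    refine ⟨C, fun f hf _ => ?_⟩
    rw [heq]
    exact hC f fun i => (hf i).aestronglyMeasurable
  exact ⟨⟨⟨weak ∘ strong, necessity _ subset_rfl⟩, ⟨strong, necessity _ subset_rfl ∘ weak⟩⟩,
    ⟨⟨weak_dyadic ∘ strong_dyadic, necessity _ hdy⟩,
      ⟨strong_dyadic, necessity _ hdy ∘ weak_dyadic⟩⟩⟩
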